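/- All super-rings are $\mathbb Z/2$-graded unital rings $R=R_0\oplus R_1$ that are super-commutative: even elements commute with all homogeneous elements, and $s^2=0$ for every odd $s$. A superscheme is a topological space with a sheaf of such super-rings all of whose stalks are local, which is locally isomorphic to affine superschemes $\mathrm{SSpec}\,R$ (the space of prime super-ideals of $R$ with its structure sheaf of functions that are locally fractions). A superscheme over a field $K$ is of finite type if it has a finite covering by open affine super-subschemes whose super-rings of sections are finitely generated $K$-superalgebras. It is irreducible if its underlying topological space is irreducible (in particular non-empty). For a Noetherian super-ring $R$ with $\mathrm{Kdim}(R_0)<\infty$, odd elements $y_1,\dots,y_s\in R_1$ form a system of odd parameters if $\mathrm{Kdim}(R_0)=\mathrm{Kdim}(R_0/\mathrm{Ann}_{R_0}(y_1\cdots y_s))$. The Krull super-dimension of $R$ is $\mathrm{Ksdim}(R)=r\mid s$, where $r=\mathrm{Kdim}(R_0)$ and $s$ is the largest length of a system of odd parameters of $R$. Proposition. Let $X$ be an irreducible superscheme of finite type over a field $K$. If $U$ and $V$ are non-empty open affine super-subschemes of $X$, then $$\mathrm{Ksdim}(\mathcal O(U))=\mathrm{Ksdim}(\mathcal O(V)).$$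 Consequently the super-dimension $\mathrm{sdim}(X)$ is well defined: there is exactly one pair $r\mid s$ of natural numbers such that for every non-empty open affine super-subscheme $U$ of $X$ the super-ring $\mathcal O(U)$ is Noetherian, $\mathrm{Kdim}(\mathcal O(U)_0)=r$ is finite, the largest length of a system of odd parameters of $\mathcal O(U)$ exists and equals $s$, and thus $\mathrm{Ksdim}(\mathcal O(U))=r\mid s$. -/

import Mathlib

open CategoryTheory TopologicalSpace Opposite AlgebraicGeometry

universe v u

noncomputable section

/-! ### Super-commutative super-rings -/

/-- A super-commutative super-ring: a `ℤ/2`-graded ring `R = R₀ ⊕ R₁` with unit such that even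
elements commute with even and with odd elements, and odd elements have square zero. -/
structure SuperRing where
  carrier : Type u
  [ring : Ring carrier]
  grading : ZMod 2 → AddSubgroup carrier
  [gradedRing : GradedRing grading]
  even_mul_comm : ∀ r ∈ grading 0, ∀ s ∈ grading 0, r * s = s * r
  even_mul_odd_comm : ∀ r ∈ grading 0, ∀ s ∈ grading 1, r * s = s * r
  odd_mul_self : ∀ s ∈ grading 1, s * s = 0

namespace SuperRing

instance : CoeSort SuperRing.{u} (Type u) := ⟨SuperRing.carrier⟩

instance (R : SuperRing.{u}) : Ring R := R.ring

instance (R : SuperRing.{u}) : GradedRing R.grading := R.gradedRing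

/-- The category of super-commutative super-rings; morphisms are the graded ring
homomorphisms. -/
instance : Category SuperRing.{u} where
  Hom R S := R.grading →+*ᵍ S.grading
  id R := GradedRingHom.id R.grading
  comp f g := GradedRingHom.comp g f

/-- The functor forgetting the grading. -/
def forgetToRing : SuperRing.{u} ⥤ RingCat.{u} where
  obj R := RingCat.of R
  map f := RingCat.ofHom (GradedRingHom.toRingHom f)

/-- The even part `R₀`, as a subring of `R`. -/
def evenSubring (R : SuperRing.{u}) : Subring R where
  carrier := R.grading 0
  mul_mem' {a b} ha hb := by
    have h := SetLike.mul_mem_graded (A := R.grading) ha hb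
    rwa [add_zero] at h
  one_mem' := SetLike.one_mem_graded R.grading
  add_mem' := (R.grading 0).add_mem
  zero_mem' := (R.grading 0).zero_mem
  neg_mem' := (R.grading 0).neg_mem

/-- The even part `R₀`, which is a commutative ring. -/
abbrev Even (R : SuperRing.{u}) : Type u := R.evenSubring

instance (R : SuperRing.{u}) : CommRing R.Even where
  __ := (inferInstance : Ring R.Even)
  mul_comm a b := Subtype.ext (R.even_mul_comm a a.2 b b.2)

lemma exists_even_add_odd (R : SuperRing.{u}) (x : R) :
    ∃ a ∈ R.grading 0, ∃ b ∈ R.grading 1, x = a + b := by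
  classical
  refine ⟨_, (DirectSum.decompose R.grading x 0).2, _, (DirectSum.decompose R.grading x 1).2, ?_⟩
  exact (DirectSum.sum_support_decompose R.grading x).symm.trans
    ((Finset.sum_subset (Finset.subset_univ _) (by simp +contextual)).trans
      (Fin.sum_univ_two _))

lemma even_central (R : SuperRing.{u}) (a : R.Even) (x : R) : (a : R) * x = x * a := by
  obtain ⟨b, hb, c, hc, rfl⟩ := R.exists_even_add_odd x
  rw [mul_add, add_mul, R.even_mul_comm a a.2 b hb, R.even_mul_odd_comm a a.2 c hc]

instance (R : SuperRing.{u}) : Algebra R.Even R :=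
  R.evenSubring.subtype.toAlgebra' R.even_central

lemma even_smul_def (R : SuperRing.{u}) (a : R.Even) (x : R) : a • x = (a : R) * x := rfl

/-- The homomorphism `R₀ → S₀` induced by a morphism of super-rings. -/
def evenMap {R S : SuperRing.{u}} (f : R ⟶ S) : R.Even →+* S.Even :=
  (GradedRingHom.toRingHom f).restrict R.evenSubring S.evenSubring
    (fun _ hx => GradedRingHom.map_mem f hx)

/-! ### Krull super-dimension -/

/-- Noetherian super-rings: the ascending chain condition for super-ideals (graded ideals; by
super-commutativity, left super-ideals are two-sided). -/
def IsNoetherian (R : SuperRing.{u}) : Prop := WellFoundedGT (HomogeneousIdeal R.grading)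

/-- Odd elements `y₁, …, y_s` form a system of odd parameters if
`Kdim R₀ = Kdim (R₀ / Ann_{R₀}(y₁ ⋯ y_s))`. -/
def IsSystemOfOddParameters (R : SuperRing.{u}) {s : ℕ} (y : Fin s → R) : Prop :=
  (∀ i, y i ∈ R.grading 1) ∧
    ringKrullDim R.Even =
      ringKrullDim (R.Even ⧸ Ideal.torsionOf R.Even R (List.ofFn y).prod)

/-- The lengths of the systems of odd parameters. -/
def oddParameterLengths (R : SuperRing.{u}) : Set ℕ :=
  {s | ∃ y : Fin s → R, R.IsSystemOfOddParameters y}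

/-- The even Krull dimension, that is, the Krull dimension of `R₀`. -/
def Ksdim₀ (R : SuperRing.{u}) : WithBot ℕ∞ := ringKrullDim R.Even

/-- The odd Krull dimension: the largest length of a system of odd parameters. -/
def Ksdim₁ (R : SuperRing.{u}) : ℕ∞ := ⨆ s ∈ R.oddParameterLengths, (s : ℕ∞)

/-- The Krull super-dimension `Ksdim R = Ksdim₀ R | Ksdim₁ R`. -/
def Ksdim (R : SuperRing.{u}) : WithBot ℕ∞ × ℕ∞ := (R.Ksdim₀, R.Ksdim₁)

/-- The super-ring `R`, viewed as a `K`-superalgebra through `φ : K → R₀`, is finitely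
generated. -/
def IsFinitelyGenerated {K : Type v} [Field K] (R : SuperRing.{u}) (φ : K →+* R.Even) : Prop :=
  ∃ t : Finset R, Subring.closure (Set.range (fun k => (φ k : R)) ∪ t) = ⊤

/-! ### The structure sheaf of an affine superscheme -/

/-- A `ℤ/2`-grading by subgroups is obtained from projections onto its two components. -/
@[reducible]
def decompositionOfProj {M : Type u} [AddCommGroup M] (A : ZMod 2 → AddSubgroup M)
    (p : ZMod 2 → M → M) (hp : ∀ i m, p i m ∈ A i) (hsum : ∀ m, p 0 m + p 1 m = m)
    (hinj : ∀ a ∈ A 0, a ∈ A 1 → a = 0) :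
    DirectSum.Decomposition A := by
  refine DirectSum.IsInternal.chooseDecomposition A ⟨?_, ?_⟩
  · classical
    rw [injective_iff_map_eq_zero]
    intro x hx
    have hx' : (x 0 : M) + (x 1 : M) = 0 := by
      rw [← hx, DirectSum.coeAddMonoidHom_eq_dfinsuppSum, DFinsupp.sum_eq_sum_fintype]
      · exact (Fin.sum_univ_two (fun i : Fin 2 => (x (i : ZMod 2) : M))).symm
      · intro i; rfl
    have h0 : (x 0 : M) = 0 := by
      refine hinj _ (x 0).2 ?_
      rw [eq_neg_of_add_eq_zero_left hx']
      exact (A 1).neg_mem (x 1).2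
    have h1 : (x 1 : M) = 0 := by rwa [h0, zero_add] at hx'
    refine DFinsupp.ext fun i => ?_
    fin_cases i
    · exact Subtype.ext h0
    · exact Subtype.ext h1
  · intro m
    refine ⟨DirectSum.of (fun i => A i) 0 ⟨_, hp 0 m⟩ +
      DirectSum.of (fun i => A i) 1 ⟨_, hp 1 m⟩, ?_⟩
    rw [map_add, DirectSum.coeAddMonoidHom_of, DirectSum.coeAddMonoidHom_of]
    exact hsum m

/-- The projection of `R` onto its component of degree `i`. -/
def proj (R : SuperRing.{u}) (i : ZMod 2) : R →ₗ[R.Even] R where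
  toFun := GradedRing.proj R.grading i
  map_add' := map_add _
  map_smul' a x := by
    have h := DirectSum.coe_decompose_mul_of_left_mem_zero R.grading (j := i) (b := x) a.2
    simpa [even_smul_def, GradedRing.proj_apply] using h

lemma proj_mem (R : SuperRing.{u}) (i : ZMod 2) (x : R) : R.proj i x ∈ R.grading i :=
  (DirectSum.decompose R.grading x i).2

lemma proj_add (R : SuperRing.{u}) (x : R) : R.proj 0 x + R.proj 1 x = x := by
  obtain ⟨a, ha, b, hb, rfl⟩ := R.exists_even_add_odd x
  have h1 : R.proj 0 a = a := DirectSum.decompose_of_mem_same R.grading ha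
  have h2 : R.proj 0 b = 0 := DirectSum.decompose_of_mem_ne R.grading hb (by decide)
  have h3 : R.proj 1 a = 0 := DirectSum.decompose_of_mem_ne R.grading ha (by decide)
  have h4 : R.proj 1 b = b := DirectSum.decompose_of_mem_same R.grading hb
  rw [map_add, map_add, h1, h2, h3, h4, add_zero, zero_add]

lemma smul_mem_grading (R : SuperRing.{u}) {i : ZMod 2} (a : R.Even) {x : R}
    (hx : x ∈ R.grading i) : a • x ∈ R.grading i := by
  have h := SetLike.mul_mem_graded (A := R.grading) a.2 hx
  rwa [zero_add] at h

lemma eq_zero_of_even_of_odd (R : SuperRing.{u}) {x : R} (h0 : x ∈ R.grading 0)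
    (h1 : x ∈ R.grading 1) : x = 0 := by
  rw [← DirectSum.decompose_of_mem_same R.grading h0]
  exact DirectSum.decompose_of_mem_ne R.grading h1 (by decide)

/-- The component of degree `i` of the localization `S⁻¹R`, for a multiplicative subset `S` of
`R₀`: the fractions `r / s` with `r ∈ R_i`. -/
def localizedGrading (R : SuperRing.{u}) (S : Submonoid R.Even) (i : ZMod 2) :
    AddSubgroup (LocalizedModule S R) where
  carrier := {z | ∃ r ∈ R.grading i, ∃ s : S, z = LocalizedModule.mk r s}
  zero_mem' := ⟨0, zero_mem _, 1, (LocalizedModule.zero_mk 1).symm⟩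
  add_mem' := by
    rintro _ _ ⟨r, hr, s, rfl⟩ ⟨r', hr', s', rfl⟩
    exact ⟨_, add_mem (R.smul_mem_grading s' hr) (R.smul_mem_grading s hr'), _,
      LocalizedModule.mk_add_mk⟩
  neg_mem' := by
    rintro _ ⟨r, hr, s, rfl⟩
    exact ⟨-r, neg_mem hr, s, LocalizedModule.mk_neg.symm⟩

/-- The localization `R_𝔭 = (R₀ ∖ 𝔭₀)⁻¹ R` at the prime super-ideal `𝔭` with even part `p`. -/
abbrev AtPrime (R : SuperRing.{u}) (p : PrimeSpectrum R.Even) : Type u :=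
  LocalizedModule p.asIdeal.primeCompl R

/-- The underlying space of `SSpec R`. A prime super-ideal `𝔭` of `R` contains all odd elements,
so `𝔭 = 𝔭₀ ⊕ R₁` and `𝔭 ↦ 𝔭₀` is a homeomorphism onto the prime spectrum of `R₀`, where
the basic open sets are the `D(f)` for `f ∈ R₀`. -/
abbrev specTop (R : SuperRing.{u}) : TopCat.{u} := TopCat.of (PrimeSpectrum R.Even)

/-- A function `h` on `U` with values `h(𝔭) ∈ R_𝔭` is locally given by a fraction. -/
def IsLocallyFraction (R : SuperRing.{u}) {U : Opens R.specTop} (h : ∀ p : U, R.AtPrime p.1) :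
    Prop :=
  ∀ p : U, ∃ V : Opens R.specTop, p.1 ∈ V ∧ ∃ (r : R) (s : R.Even),
    ∀ q : U, q.1 ∈ V → ∃ hs : s ∉ q.1.asIdeal, h q = LocalizedModule.mk r ⟨s, hs⟩

/-- The functions `h` on `U` with `h(𝔭) ∈ R_𝔭` which are locally given by a fraction. -/
def specSections (R : SuperRing.{u}) (U : Opens R.specTop) :
    Subring (∀ p : U, R.AtPrime p.1) where
  carrier := {h | R.IsLocallyFraction h}
  zero_mem' p := ⟨⊤, trivial, 0, 1, fun q _ =>
    ⟨q.1.asIdeal.primeCompl.one_mem, (LocalizedModule.zero_mk _).symm⟩⟩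
  one_mem' p := ⟨⊤, trivial, 1, 1, fun q _ => ⟨q.1.asIdeal.primeCompl.one_mem, OreLocalization.one_def⟩⟩
  add_mem' := by
    intro a b ha hb p
    obtain ⟨V, hV, r, s, h⟩ := ha p
    obtain ⟨V', hV', r', s', h'⟩ := hb p
    refine ⟨V ⊓ V', ⟨hV, hV'⟩, s' • r + s • r', s * s', fun q hq => ?_⟩
    obtain ⟨hs, e⟩ := h q hq.1
    obtain ⟨hs', e'⟩ := h' q hq.2
    exact ⟨q.1.asIdeal.primeCompl.mul_mem hs hs',
      (congrArg₂ (· + ·) e e').trans LocalizedModule.mk_add_mk⟩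
  mul_mem' := by
    intro a b ha hb p
    obtain ⟨V, hV, r, s, h⟩ := ha p
    obtain ⟨V', hV', r', s', h'⟩ := hb p
    refine ⟨V ⊓ V', ⟨hV, hV'⟩, r * r', s * s', fun q hq => ?_⟩
    obtain ⟨hs, e⟩ := h q hq.1
    obtain ⟨hs', e'⟩ := h' q hq.2
    exact ⟨q.1.asIdeal.primeCompl.mul_mem hs hs',
      (congrArg₂ (· * ·) e e').trans LocalizedModule.mk_mul_mk⟩
  neg_mem' := by
    intro a ha p
    obtain ⟨V, hV, r, s, h⟩ := ha p
    refine ⟨V, hV, -r, s, fun q hq => ?_⟩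
    obtain ⟨hs, e⟩ := h q hq
    exact ⟨hs, (congrArg Neg.neg e).trans LocalizedModule.mk_neg.symm⟩

lemma specSections_isLocallyFraction (R : SuperRing.{u}) {U : Opens R.specTop}
    (h : R.specSections U) : R.IsLocallyFraction h.1 := h.2

/-- A section is homogeneous of degree `i` if all its values are. -/
def specGrading (R : SuperRing.{u}) (U : Opens R.specTop) (i : ZMod 2) :
    AddSubgroup (R.specSections U) where
  carrier := {h | ∀ p : U, h.1 p ∈ R.localizedGrading p.1.asIdeal.primeCompl i}
  zero_mem' _ := zero_mem _
  add_mem' ha hb p := add_mem (ha p) (hb p)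
  neg_mem' ha p := neg_mem (ha p)

lemma localizedGrading_mul_mem (R : SuperRing.{u}) (S : Submonoid R.Even) {i j : ZMod 2}
    {a b : LocalizedModule S R} (ha : a ∈ R.localizedGrading S i)
    (hb : b ∈ R.localizedGrading S j) : a * b ∈ R.localizedGrading S (i + j) := by
  obtain ⟨r, hr, s, rfl⟩ := ha
  obtain ⟨r', hr', s', rfl⟩ := hb
  exact ⟨r * r', SetLike.mul_mem_graded hr hr', s * s', LocalizedModule.mk_mul_mk⟩

lemma localizedGrading_inter (R : SuperRing.{u}) (S : Submonoid R.Even)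
    {a : LocalizedModule S R} (h0 : a ∈ R.localizedGrading S 0)
    (h1 : a ∈ R.localizedGrading S 1) : a = 0 := by
  obtain ⟨r, hr, s, rfl⟩ := h0
  obtain ⟨r', hr', s', e⟩ := h1
  obtain ⟨w, hw⟩ := LocalizedModule.mk_eq.mp e
  have hz : w • s' • r = 0 := by
    refine R.eq_zero_of_even_of_odd (R.smul_mem_grading w (R.smul_mem_grading s' hr)) ?_
    rw [hw]
    exact R.smul_mem_grading w (R.smul_mem_grading s hr')
  rw [← LocalizedModule.zero_mk s', LocalizedModule.mk_eq]
  exact ⟨w, by rw [hz, smul_zero, smul_zero]⟩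

/-- The component of degree `i` of a section. -/
def specProj (R : SuperRing.{u}) (U : Opens R.specTop) (i : ZMod 2) (h : R.specSections U) :
    R.specSections U :=
  ⟨fun p => LocalizedModule.map p.1.asIdeal.primeCompl (R.proj i) (h.1 p), fun p => by
    obtain ⟨V, hV, r, s, e⟩ := R.specSections_isLocallyFraction h p
    refine ⟨V, hV, R.proj i r, s, fun q hq => ?_⟩
    obtain ⟨hs, e⟩ := e q hq
    exact ⟨hs, (congrArg (LocalizedModule.map q.1.asIdeal.primeCompl (R.proj i)) e).trans
      (LocalizedModule.map_mk _ _ _ _)⟩⟩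

instance (R : SuperRing.{u}) (U : Opens R.specTop) : GradedRing (R.specGrading U) where
  one_mem _ := ⟨1, SetLike.one_mem_graded _, 1, OreLocalization.one_def⟩
  mul_mem _ _ _ _ ha hb p := R.localizedGrading_mul_mem _ (ha p) (hb p)
  toDecomposition := decompositionOfProj _ (R.specProj U)
    (by
      intro i h p
      obtain ⟨V, hV, r, s, e⟩ := R.specSections_isLocallyFraction h p
      obtain ⟨hs, e⟩ := e p hV
      refine ⟨R.proj i r, R.proj_mem i r, ⟨s, hs⟩, ?_⟩
      simp only [specProj]
      rw [e, LocalizedModule.map_mk])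
    (by
      intro h
      refine Subtype.ext (funext fun p => ?_)
      obtain ⟨V, hV, r, s, e⟩ := R.specSections_isLocallyFraction h p
      obtain ⟨hs, e⟩ := e p hV
      simp only [specProj, Subring.coe_add, Pi.add_apply]
      rw [e, LocalizedModule.map_mk, LocalizedModule.map_mk, LocalizedModule.mk_add_mk,
        ← smul_add, proj_add, LocalizedModule.mk_cancel_common_left])
    (fun a h0 h1 => Subtype.ext (funext fun p => R.localizedGrading_inter _ (h0 p) (h1 p)))

lemma localizedGrading_comm (R : SuperRing.{u}) (S : Submonoid R.Even) {i : ZMod 2}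
    {a b : LocalizedModule S R} (ha : a ∈ R.localizedGrading S 0)
    (hb : b ∈ R.localizedGrading S i) : a * b = b * a := by
  obtain ⟨r, hr, s, rfl⟩ := ha
  obtain ⟨r', hr', s', rfl⟩ := hb
  rw [LocalizedModule.mk_mul_mk, LocalizedModule.mk_mul_mk, mul_comm s s',
    R.even_central ⟨r, hr⟩ r']

/-- The super-ring of sections of the structure sheaf of `SSpec R` over `U`. -/
def specSuperRing (R : SuperRing.{u}) (U : Opens R.specTop) : SuperRing.{u} where
  carrier := R.specSections U
  grading := R.specGrading U
  even_mul_comm a ha b hb :=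
    Subtype.ext (funext fun p => R.localizedGrading_comm _ (ha p) (hb p))
  even_mul_odd_comm a ha b hb :=
    Subtype.ext (funext fun p => R.localizedGrading_comm _ (ha p) (hb p))
  odd_mul_self a ha := by
    refine Subtype.ext (funext fun p => ?_)
    obtain ⟨r, hr, s, e⟩ := ha p
    change a.1 p * a.1 p = 0
    rw [e, LocalizedModule.mk_mul_mk, R.odd_mul_self r hr, LocalizedModule.zero_mk]

/-- The restriction map for sections of the structure sheaf of `SSpec R`. -/
def specRes (R : SuperRing.{u}) {U V : Opens R.specTop} (hVU : V ≤ U) :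
    R.specSuperRing U ⟶ R.specSuperRing V where
  toFun h := ⟨fun p => h.1 ⟨p.1, hVU p.2⟩, fun p => by
    obtain ⟨W, hW, r, s, e⟩ := R.specSections_isLocallyFraction h ⟨p.1, hVU p.2⟩
    exact ⟨W, hW, r, s, fun q hq => e ⟨q.1, hVU q.2⟩ hq⟩⟩
  map_one' := rfl
  map_mul' _ _ := rfl
  map_zero' := rfl
  map_add' _ _ := rfl
  map_mem h p := h ⟨p.1, hVU p.2⟩

/-- The structure presheaf of `SSpec R`. -/
def specPresheaf (R : SuperRing.{u}) : TopCat.Presheaf SuperRing.{u} R.specTop where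
  obj U := R.specSuperRing U.unop
  map f := R.specRes (leOfHom f.unop)
  map_id _ := rfl
  map_comp _ _ := rfl

lemma specPresheaf_isSheaf (R : SuperRing.{u}) : R.specPresheaf.IsSheaf := by
  intro E U S hS x hx
  have hS' : ∀ p : U, ∃ (V : Opens R.specTop) (f : V ⟶ U), S f ∧ p.1 ∈ V :=
    fun p => hS p.1 p.2
  choose W f hf hW using hS'
  let y : ∀ {V : Opens R.specTop} (g : V ⟶ U), S g →
      (E.grading →+*ᵍ (R.specSuperRing V).grading) := fun g hg => x g hg
  have key : ∀ {V : Opens R.specTop} (g : V ⟶ U) (hg : S g) (p : U) (hp : p.1 ∈ V) (e : E),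
      (y (f p) (hf p) e).1 ⟨p.1, hW p⟩ =
        (y g hg e).1 ⟨p.1, hp⟩ := by
    intro V g hg p hp e
    have h := hx (homOfLE inf_le_left : W p ⊓ V ⟶ W p) (homOfLE inf_le_right) (hf p) hg
      (Subsingleton.elim _ _)
    exact congrArg (fun k : E.grading →+*ᵍ (R.specSuperRing (W p ⊓ V)).grading =>
      (k e).1 ⟨p.1, hW p, hp⟩) h
  let t : E.grading →+*ᵍ (R.specSuperRing U).grading :=
    { toFun := fun e => ⟨fun p =>
        (y (f p) (hf p) e).1 ⟨p.1, hW p⟩, by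
        intro p
        obtain ⟨V, hV, r, s, h⟩ := R.specSections_isLocallyFraction
          (y (f p) (hf p) e) ⟨p.1, hW p⟩
        refine ⟨V ⊓ W p, ⟨hV, hW p⟩, r, s, fun q hq => ?_⟩
        obtain ⟨hs, h⟩ := h ⟨q.1, hq.2⟩ hq.1
        exact ⟨hs, (key (f p) (hf p) q hq.2 e).trans h⟩⟩
      map_one' := Subtype.ext (funext fun p => congrArg (fun z => z.1 ⟨p.1, hW p⟩)
        (GradedRingHom.map_one (y (f p) (hf p))))
      map_mul' := fun a b => Subtype.ext (funext fun p => congrArg (fun z => z.1 ⟨p.1, hW p⟩)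
        (GradedRingHom.map_mul (y (f p) (hf p)) a b))
      map_zero' := Subtype.ext (funext fun p => congrArg (fun z => z.1 ⟨p.1, hW p⟩)
        (GradedRingHom.map_zero (y (f p) (hf p))))
      map_add' := fun a b => Subtype.ext (funext fun p => congrArg (fun z => z.1 ⟨p.1, hW p⟩)
        (GradedRingHom.map_add (y (f p) (hf p)) a b))
      map_mem := fun {i e} he p => GradedRingHom.map_mem (y (f p) (hf p)) he ⟨p.1, hW p⟩ }
  refine ⟨t, ?_, ?_⟩
  · intro V g hg
    refine GradedRingHom.ext fun e => Subtype.ext (funext fun p => ?_)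
    exact key g hg ⟨p.1, leOfHom g p.2⟩ p.2 e
  · intro t' ht'
    refine GradedRingHom.ext fun e => Subtype.ext (funext fun p => ?_)
    exact congrArg (fun k : E.grading →+*ᵍ (R.specSuperRing (W p)).grading =>
      (k e).1 ⟨p.1, hW p⟩) (ht' (f p) (hf p))

end SuperRing

/-! ### Superschemes -/

/-- The affine superscheme `SSpec R`, as a space with a sheaf of super-rings. -/
def SSpec (R : SuperRing.{u}) : SheafedSpace.{u + 1, u, u} SuperRing.{u} where
  carrier := R.specTop
  presheaf := R.specPresheaf
  IsSheaf := R.specPresheaf_isSheaf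

/-- A geometric superspace: a topological space with a sheaf of super-commutative super-rings all
of whose stalks are local. (A super-commutative super-ring has a unique maximal super-ideal if and
only if it is local as a ring.) -/
structure GeometricSuperspace extends SheafedSpace.{u + 1, u, u} SuperRing.{u} where
  isLocalRing_stalk : ∀ x : carrier,
    IsLocalRing (TopCat.Presheaf.stalk (C := RingCat.{u}) (presheaf ⋙ SuperRing.forgetToRing) x)

namespace GeometricSuperspace

/-- The super-ring of sections `𝒪(U)`. -/
abbrev sections (X : GeometricSuperspace.{u}) (U : Opens X.carrier) : SuperRing.{u} :=
  X.presheaf.obj (op U)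

/-- The open super-subspace `(U, 𝒪|_U)` is isomorphic to `SSpec R` for some super-ring `R`.
(An isomorphism of spaces with sheaves of super-rings induces isomorphisms, hence local
morphisms, on the stalks.) -/
def IsAffineOpen (X : GeometricSuperspace.{u}) (U : Opens X.carrier) : Prop :=
  ∃ R : SuperRing.{u}, Nonempty (X.toSheafedSpace.restrict U.isOpenEmbedding ≅ SSpec R)

end GeometricSuperspace

/-- A superscheme: a geometric superspace which is covered by open affine super-subspaces. -/
structure Superscheme extends GeometricSuperspace.{u} where
  exists_isAffineOpen : ∀ x : carrier,
    ∃ U : Opens carrier, x ∈ U ∧ toGeometricSuperspace.IsAffineOpen U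

namespace Superscheme

/-- A structure of superscheme over a field `K`, that is, a morphism to the spectrum of `K`, given
as a homomorphism from `K` to the even global sections. It makes `𝒪` a sheaf of
`K`-superalgebras. -/
abbrev StructureMap (X : Superscheme.{u}) (K : Type v) [Field K] : Type (max v u) :=
  K →+* (X.sections ⊤).Even

/-- The `K`-superalgebra structure of `𝒪(U)`. -/
def structureMapOn (X : Superscheme.{u}) {K : Type v} [Field K] (φ : X.StructureMap K)
    (U : Opens X.carrier) : K →+* (X.sections U).Even :=
  (SuperRing.evenMap (X.presheaf.map (homOfLE le_top : U ⟶ ⊤).op)).comp φ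

/-- `X` is of finite type over `K`: it has a finite covering by open affine super-subschemes whose
super-rings of sections are finitely generated `K`-superalgebras. -/
def IsOfFiniteType (X : Superscheme.{u}) {K : Type v} [Field K] (φ : X.StructureMap K) : Prop :=
  ∃ (n : ℕ) (U : Fin n → Opens X.carrier), (⨆ i, U i) = ⊤ ∧
    ∀ i, X.IsAffineOpen (U i) ∧ (X.sections (U i)).IsFinitelyGenerated (X.structureMapOn φ (U i))

end Superscheme

end

/-! ### Krull dimension of finitely generated algebras with prime nilradical. -/

noncomputable section

/-! Irreducibility of `X` makes the nilradical of `𝒪(U)₀` prime for every non-empty affine `U`. In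
finite dimension, passing to `R₀ / I` then keeps the Krull dimension exactly when `I` consists of
nilpotents (`ringKrullDim_quotient_eq_iff`). So odd elements form a system of odd parameters exactly
when the annihilator of their product is nil, a condition that no longer mentions dimension and is
unchanged by inverting a non-nilpotent even element (`IsAway.hasOddProduct_iff`). The Krull
dimension is unchanged too: modulo nilradicals it is a transcendence degree over `K`.

Two non-empty affine opens meet, and around a common point there is an open set that is basic in
both (`IsChart.exists_common_isAway`). Both super-rings thus share a localization, which gives equal
super-dimensions.

The same device spreads finiteness from the given covering to all affine opens: `R₀` is of finite
type over `K` and `R` is a finite `R₀`-module. Hence `R` is Noetherian, its dimension is finite, and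
systems of odd parameters have bounded length, since a product of more odd elements than there are
module generators vanishes. -/

theorem ringKrullDim_eq_of_isIntegral {A B : Type*} [CommRing A] [CommRing B] [Algebra A B]
    [Algebra.IsIntegral A B] (hinj : Function.Injective (algebraMap A B)) :
    ringKrullDim B = ringKrullDim A := by
  apply le_antisymm
  · refine Order.krullDim_le_of_strictMono (PrimeSpectrum.comap (algebraMap A B)) ?_
    intro p q hpq
    exact Ideal.IsIntegral.comap_lt_comap (R := A) (I := p.asIdeal) (J := q.asIdeal) hpq
  · rw [ringKrullDim, ringKrullDim, Order.krullDim, Order.krullDim]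
    refine iSup_le fun l => ?_
    obtain ⟨Q, -, hQ, hlo⟩ := Ideal.exists_ideal_over_prime_of_isIntegral l.head.asIdeal
      (⊥ : Ideal B) (by
        rw [← RingHom.ker_eq_comap_bot, (RingHom.injective_iff_ker_eq_bot _).mp hinj]
        exact bot_le)
    have : Q.LiesOver l.head.asIdeal := ⟨hlo.symm⟩
    obtain ⟨L, hL, -⟩ := Ideal.exists_ltSeries_of_hasGoingUp l Q
    rw [← hL]
    exact le_iSup (fun p : LTSeries (PrimeSpectrum B) => (p.length : WithBot ℕ∞)) L

/-- Noether normalization: `A` is integral over a polynomial ring in `n` variables, and neither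
invariant changes along an injective integral extension. -/
theorem ringKrullDim_eq_and_trdeg_eq (K : Type v) (A : Type u) [Field K] [CommRing A] [IsDomain A]
    [Algebra K A] [Algebra.FiniteType K A] :
    ∃ n : ℕ, ringKrullDim A = n ∧ Algebra.trdeg K A = n := by
  obtain ⟨n, g, hg, hint⟩ := exists_integral_inj_algHom_of_fg K A
  refine ⟨n, ?_, ?_⟩
  · let _ := g.toRingHom.toAlgebra
    have : Algebra.IsIntegral (MvPolynomial (Fin n) K) A := ⟨hint⟩
    rw [ringKrullDim_eq_of_isIntegral (A := MvPolynomial (Fin n) K) hg]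
    rw [MvPolynomial.ringKrullDim_of_isNoetherianRing]
    simp
  · let _ := g.toRingHom.toAlgebra
    have : Algebra.IsIntegral (MvPolynomial (Fin n) K) A := ⟨hint⟩
    have : IsScalarTower K (MvPolynomial (Fin n) K) A :=
      IsScalarTower.of_algebraMap_eq fun x => (g.commutes x).symm
    have : FaithfulSMul (MvPolynomial (Fin n) K) A :=
      (faithfulSMul_iff_algebraMap_injective _ _).mpr hg
    have h := lift_trdeg_add_eq K (MvPolynomial (Fin n) K) A
    rw [trdeg_eq_zero (R := MvPolynomial (Fin n) K), MvPolynomial.trdeg_of_isDomain] at h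
    simpa using h.symm

/-- Both dimensions are transcendence degrees over `K`, and `B` is algebraic over `A`. -/
theorem ringKrullDim_eq_of_away (K : Type v) (A B : Type u) [Field K] [CommRing A] [IsDomain A]
    [Algebra K A] [Algebra.FiniteType K A] [CommRing B] [Algebra A B] {f : A} (hf : f ≠ 0)
    [IsLocalization.Away f B] : ringKrullDim B = ringKrullDim A := by
  let _ : Algebra K B := ((algebraMap A B).comp (algebraMap K A)).toAlgebra
  have : IsScalarTower K A B := IsScalarTower.of_algebraMap_eq' rfl
  have hle : Submonoid.powers f ≤ nonZeroDivisors A := powers_le_nonZeroDivisors_of_noZeroDivisors hf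
  have : IsDomain B := IsLocalization.isDomain_of_le_nonZeroDivisors (M := Submonoid.powers f) B hle
  have : Algebra.FiniteType A B := IsLocalization.finiteType_of_monoid_fg (Submonoid.powers f) B
  have : Algebra.FiniteType K B := Algebra.FiniteType.trans (S := A) ‹_› ‹_›
  have : FaithfulSMul A B := (faithfulSMul_iff_algebraMap_injective A B).mpr
    (IsLocalization.injective B hle)
  have : Algebra.IsAlgebraic A B := IsLocalization.isAlgebraic B (Submonoid.powers f)
  obtain ⟨n, h1, h2⟩ := ringKrullDim_eq_and_trdeg_eq K A
  obtain ⟨m, h3, h4⟩ := ringKrullDim_eq_and_trdeg_eq K B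
  have h := trdeg_add_eq K A (A := B)
  rw [trdeg_eq_zero (R := A), add_zero, h2, h4] at h
  rw [h1, h3, Nat.cast_injective h]

theorem ringKrullDim_quotient_congr {A : Type*} [CommRing A] {I J : Ideal A}
    (h : I.radical = J.radical) : ringKrullDim (A ⧸ I) = ringKrullDim (A ⧸ J) := by
  rw [ringKrullDim_quotient, ringKrullDim_quotient, ← PrimeSpectrum.zeroLocus_radical, h,
    PrimeSpectrum.zeroLocus_radical]

theorem ringKrullDim_quotient_nilradical (A : Type*) [CommRing A] :
    ringKrullDim (A ⧸ nilradical A) = ringKrullDim A := by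
  rw [ringKrullDim_quotient_congr (I := nilradical A) (J := ⊥) (Ideal.radical_idem _)]
  exact ringKrullDim_eq_of_ringEquiv (RingEquiv.quotientBot A)

/-- A non-nilpotent `a ∈ I` is a nonzerodivisor in the domain `A ⧸ nilradical A`, so killing `I`
there lowers a finite dimension by at least one. Adding the nilradical to `I` does not affect the
dimension of the quotient. -/
theorem ringKrullDim_quotient_eq_iff {A : Type*} [CommRing A] (hN : (nilradical A).IsPrime)
    (hd : ringKrullDim A ≠ ⊤) (I : Ideal A) :
    ringKrullDim A = ringKrullDim (A ⧸ I) ↔ I ≤ nilradical A := by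
  constructor
  · intro h a ha
    by_contra hna
    have h1 := ringKrullDim_succ_le_of_surjective
      (Ideal.Quotient.factor (le_sup_right : nilradical A ≤ I ⊔ nilradical A))
      (Ideal.Quotient.factor_surjective _) (r := Ideal.Quotient.mk _ a)
      (mem_nonZeroDivisors_of_ne_zero (by rwa [Ne, Ideal.Quotient.eq_zero_iff_mem]))
      (by rw [Ideal.Quotient.factor_mk, Ideal.Quotient.eq_zero_iff_mem]
          exact Ideal.mem_sup_left ha)
    rw [ringKrullDim_quotient_nilradical, ringKrullDim_quotient_congr (J := I), ← h] at h1
    · have : Nontrivial A := by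
        by_contra hn
        rw [not_nontrivial_iff_subsingleton] at hn
        exact hna (by rw [Subsingleton.elim a 0]; exact zero_mem _)
      -- The inequality `d + 1 ≤ d` is contradictory only for finite `d`: it holds for both `⊥` and
      -- `⊤`, which have to be excluded.
      have h0 : 0 ≤ ringKrullDim A := ringKrullDim_nonneg_of_nontrivial
      revert h1 hd h0
      generalize ringKrullDim A = d
      intro hd h1 h0
      induction d with
      | bot => simp at h0
      | coe d =>
        induction d with
        | top => exact hd rfl
        | coe d =>
          have : ((d + 1 : ℕ) : WithBot ℕ∞) ≤ (d : ℕ) := by exact_mod_cast h1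
          have := Nat.cast_le.mp this
          omega
    · refine le_antisymm ?_ (Ideal.radical_mono le_sup_left)
      refine (Ideal.radical_mono (sup_le Ideal.le_radical ?_)).trans (Ideal.radical_idem I).le
      exact Ideal.radical_mono bot_le
  · intro h
    rw [← ringKrullDim_quotient_nilradical, ringKrullDim_quotient_congr (J := I)]
    rw [nilradical, Ideal.radical_idem]
    exact le_antisymm (Ideal.radical_mono bot_le)
      ((Ideal.radical_mono h).trans (Ideal.radical_idem _).le)

theorem IsLocalization.Away.of_pow_mul {A B : Type*} [CommRing A] [CommRing B] [Algebra A B] {f : A}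
    (hu : IsUnit (algebraMap A B f))
    (hs : ∀ b : B, ∃ (n : ℕ) (a : A), algebraMap A B f ^ n * b = algebraMap A B a)
    (hz : ∀ a : A, algebraMap A B a = 0 → ∃ n : ℕ, f ^ n * a = 0) :
    IsLocalization.Away f B where
  map_units := by
    rintro ⟨_, n, rfl⟩
    simpa using hu.pow n
  surj b := by
    obtain ⟨n, a, h⟩ := hs b
    exact ⟨(a, ⟨f ^ n, n, rfl⟩), by simpa [mul_comm] using h⟩
  exists_of_eq {x y} h := by
    obtain ⟨n, hn⟩ := hz (x - y) (by rw [map_sub, h, sub_self])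
    exact ⟨⟨f ^ n, n, rfl⟩, by simpa [mul_sub, sub_eq_zero] using hn⟩

theorem algebraMap_mem_nilradical_iff_of_away {A B : Type*} [CommRing A] [CommRing B] [Algebra A B]
    (hN : (nilradical A).IsPrime) {f : A} (hf : f ∉ nilradical A) [IsLocalization.Away f B]
    {a : A} : algebraMap A B a ∈ nilradical B ↔ a ∈ nilradical A := by
  refine ⟨fun h => ?_, fun h => ?_⟩
  · obtain ⟨n, hn⟩ := mem_nilradical.mp h
    rw [← map_pow, IsLocalization.map_eq_zero_iff (Submonoid.powers f)] at hn
    obtain ⟨⟨_, m, rfl⟩, hm⟩ := hn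
    have h0 : f ^ m * a ^ n ∈ nilradical A := by
      change f ^ m * a ^ n = 0 at hm
      rw [hm]
      exact zero_mem _
    exact hN.mem_of_pow_mem n ((hN.mem_or_mem h0).resolve_left fun h => hf (hN.mem_of_pow_mem m h))
  · exact mem_nilradical.mpr ((mem_nilradical.mp h).map (algebraMap A B))

/-- Reduction to domains: `B` modulo its nilradical is the localization of `A` modulo its nilradical
at the class of `f`, which is nonzero. -/
theorem ringKrullDim_eq_of_away_of_isPrime (K : Type v) (A B : Type u) [Field K] [CommRing A]
    [Algebra K A] [Algebra.FiniteType K A] [CommRing B] [Algebra A B]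
    (hN : (nilradical A).IsPrime) {f : A} (hf : f ∉ nilradical A)
    [IsLocalization.Away f B] : ringKrullDim B = ringKrullDim A := by
  have key {a : A} := algebraMap_mem_nilradical_iff_of_away (B := B) hN hf (a := a)
  have hu : IsUnit (algebraMap A B f) := IsLocalization.Away.algebraMap_isUnit f
  let φ : A ⧸ nilradical A →+* B ⧸ nilradical B :=
    Ideal.quotientMap _ (algebraMap A B) fun a ha => key.mpr ha
  let _ : Algebra (A ⧸ nilradical A) (B ⧸ nilradical B) := φ.toAlgebra
  have hφ (a : A) : algebraMap (A ⧸ nilradical A) (B ⧸ nilradical B) (Ideal.Quotient.mk _ a) =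
    Ideal.Quotient.mk _ (algebraMap A B a) := rfl
  have : IsLocalization.Away (Ideal.Quotient.mk (nilradical A) f) (B ⧸ nilradical B) := by
    refine .of_pow_mul (hu.map (Ideal.Quotient.mk (nilradical B))) ?_ ?_
    · intro b
      obtain ⟨b, rfl⟩ := Ideal.Quotient.mk_surjective b
      obtain ⟨n, a, h⟩ := IsLocalization.Away.surj f b
      exact ⟨n, Ideal.Quotient.mk _ a, by rw [hφ, hφ, ← h, ← map_pow, ← map_mul, mul_comm]⟩
    · intro a ha
      obtain ⟨a, rfl⟩ := Ideal.Quotient.mk_surjective a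
      rw [hφ, Ideal.Quotient.eq_zero_iff_mem, key] at ha
      exact ⟨0, by rw [Ideal.Quotient.eq_zero_iff_mem.mpr ha, mul_zero]⟩
  have := ringKrullDim_eq_of_away K (A ⧸ nilradical A) (B ⧸ nilradical B)
    (f := Ideal.Quotient.mk _ f) (by rwa [Ne, Ideal.Quotient.eq_zero_iff_mem])
  rwa [ringKrullDim_quotient_nilradical, ringKrullDim_quotient_nilradical] at this

theorem exists_ringKrullDim_eq_natCast (K : Type v) (A : Type u) [Field K] [CommRing A]
    [Algebra K A] [Algebra.FiniteType K A] (hN : (nilradical A).IsPrime) :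
    ∃ n : ℕ, ringKrullDim A = n := by
  obtain ⟨n, h, -⟩ := ringKrullDim_eq_and_trdeg_eq K (A ⧸ nilradical A)
  exact ⟨n, by rwa [ringKrullDim_quotient_nilradical] at h⟩

end

/-! ### Localization of super-rings at an even element, finiteness, and odd parameters. -/

noncomputable section

namespace SuperRing

variable {R S : SuperRing.{u}}

/-- The ring homomorphism underlying a morphism of super-rings. -/
abbrev ringHom (ρ : R ⟶ S) : R →+* S := GradedRingHom.toRingHom ρ

lemma ringHom_mem (ρ : R ⟶ S) {i : ZMod 2} {x : R} (hx : x ∈ R.grading i) :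
    ringHom ρ x ∈ S.grading i :=
  GradedRingHom.map_mem ρ hx

lemma coe_evenMap (ρ : R ⟶ S) (a : R.Even) : (evenMap ρ a : S) = ringHom ρ a := rfl

lemma ringHom_smul (ρ : R ⟶ S) (a : R.Even) (x : R) :
    ringHom ρ (a • x) = evenMap ρ a • ringHom ρ x := by
  rw [even_smul_def, even_smul_def, map_mul, coe_evenMap]

lemma proj_of_mem {i : ZMod 2} {x : R} (hx : x ∈ R.grading i) : R.proj i x = x :=
  DirectSum.decompose_of_mem_same R.grading hx

lemma proj_of_mem_ne {i j : ZMod 2} (hij : i ≠ j) {x : R} (hx : x ∈ R.grading i) :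
    R.proj j x = 0 :=
  DirectSum.decompose_of_mem_ne R.grading hx hij

lemma ringHom_proj (ρ : R ⟶ S) (i : ZMod 2) (x : R) :
    ringHom ρ (R.proj i x) = S.proj i (ringHom ρ x) := by
  obtain ⟨a, ha, b, hb, rfl⟩ := R.exists_even_add_odd x
  have h01 : (0 : ZMod 2) ≠ 1 := by decide
  fin_cases i
  · change ringHom ρ (R.proj 0 _) = S.proj 0 _
    rw [map_add, map_add, map_add, map_add, proj_of_mem ha, proj_of_mem_ne h01.symm hb,
      proj_of_mem (ringHom_mem ρ ha), proj_of_mem_ne h01.symm (ringHom_mem ρ hb), map_zero]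
  · change ringHom ρ (R.proj 1 _) = S.proj 1 _
    rw [map_add, map_add, map_add, map_add, proj_of_mem hb, proj_of_mem_ne h01 ha,
      proj_of_mem (ringHom_mem ρ hb), proj_of_mem_ne h01 (ringHom_mem ρ ha), map_zero]

/-- A morphism of super-rings `ρ : R ⟶ S` exhibits `S` as the localization of `R` away from the
even element `f`. -/
structure IsAway (ρ : R ⟶ S) (f : R.Even) : Prop where
  isUnit : IsUnit (evenMap ρ f)
  surj : ∀ y : S, ∃ (n : ℕ) (x : R), evenMap ρ f ^ n • y = ringHom ρ x
  exists_pow_smul_eq_zero : ∀ x : R, ringHom ρ x = 0 → ∃ n : ℕ, f ^ n • x = 0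

/-- Multiplying by the even `f` preserves degrees, so the numerator may be replaced by its component
of degree `i`. -/
lemma IsAway.surj_of_mem {ρ : R ⟶ S} {f : R.Even} (h : IsAway ρ f) {i : ZMod 2} {y : S}
    (hy : y ∈ S.grading i) : ∃ (n : ℕ), ∃ x ∈ R.grading i, evenMap ρ f ^ n • y = ringHom ρ x := by
  obtain ⟨n, x, hx⟩ := h.surj y
  refine ⟨n, R.proj i x, R.proj_mem i x, ?_⟩
  rw [ringHom_proj, ← hx, proj_of_mem (S.smul_mem_grading _ hy)]

lemma IsAway.isLocalization {ρ : R ⟶ S} {f : R.Even} (h : IsAway ρ f) :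
    @IsLocalization.Away _ _ f S.Even _ (evenMap ρ).toAlgebra := by
  let _ := (evenMap ρ).toAlgebra
  refine .of_pow_mul h.isUnit ?_ ?_
  · intro b
    obtain ⟨n, x, hx, e⟩ := h.surj_of_mem b.2
    exact ⟨n, ⟨x, hx⟩, Subtype.ext e⟩
  · intro a ha
    obtain ⟨n, hn⟩ := h.exists_pow_smul_eq_zero a (congrArg Subtype.val ha)
    exact ⟨n, Subtype.ext hn⟩

/-- The even part of `R` is a `K`-algebra of finite type and `R` is finite over its even part. -/
structure IsFiniteTypeOver {K : Type v} [Field K] (R : SuperRing.{u}) (φ : K →+* R.Even) :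
    Prop where
  finiteType : φ.FiniteType
  finite : Module.Finite R.Even R

variable {K : Type v} [Field K] {φ : K →+* R.Even}

lemma IsFiniteTypeOver.of_isAway (hφ : R.IsFiniteTypeOver φ) {ρ : R ⟶ S} {f : R.Even}
    (h : IsAway ρ f) : S.IsFiniteTypeOver ((evenMap ρ).comp φ) where
  finiteType := by
    refine RingHom.FiniteType.comp ?_ hφ.finiteType
    let _ := (evenMap ρ).toAlgebra
    have := h.isLocalization
    exact IsLocalization.finiteType_of_monoid_fg (Submonoid.powers f) S.Even
  finite := by
    obtain ⟨t, ht⟩ := hφ.finite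
    classical
    refine ⟨t.image (ringHom ρ), eq_top_iff.mpr fun y _ => ?_⟩
    obtain ⟨n, x, hx⟩ := h.surj y
    have hx' : ringHom ρ x ∈ Submodule.span S.Even (t.image (ringHom ρ) : Set S) := by
      clear hx
      have hxt : x ∈ Submodule.span R.Even (t : Set R) := ht ▸ trivial
      induction hxt using Submodule.span_induction with
      | mem x hx => exact Submodule.subset_span (by simpa using ⟨x, hx, rfl⟩)
      | zero => rw [map_zero]; exact zero_mem _
      | add x y _ _ hx hy => rw [map_add]; exact add_mem hx hy
      | smul a x _ hx => rw [ringHom_smul]; exact Submodule.smul_mem _ _ hx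
    rw [← hx] at hx'
    exact (Submodule.smul_mem_iff_of_isUnit _ (h.isUnit.pow n)).mp hx'

/-- The admissible `f` lie in no common prime, hence generate the unit ideal; finite type of
algebras and finiteness of modules can both be checked on such a family of localizations. -/
lemma IsFiniteTypeOver.of_forall_exists_isAway
    (h : ∀ p : PrimeSpectrum R.Even, ∃ f : R.Even, f ∉ p.asIdeal ∧ ∃ (S : SuperRing.{u}) (ρ : R ⟶ S),
      IsAway ρ f ∧ S.IsFiniteTypeOver ((evenMap ρ).comp φ)) :
    R.IsFiniteTypeOver φ := by
  let t : Set R.Even := {f | ∃ (S : SuperRing.{u}) (ρ : R ⟶ S),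
    IsAway ρ f ∧ S.IsFiniteTypeOver ((evenMap ρ).comp φ)}
  have ht : Ideal.span t = ⊤ := by
    by_contra hne
    obtain ⟨m, hm, hle⟩ := Ideal.exists_le_maximal _ hne
    obtain ⟨f, hf, hft⟩ := h ⟨m, hm.isPrime⟩
    exact hf (hle (Ideal.subset_span hft))
  constructor
  · let _ := φ.toAlgebra
    refine Algebra.FiniteType.of_span_eq_top_target t ht fun f hf => ?_
    obtain ⟨S, ρ, hρ, hft⟩ := hf
    let _ := (evenMap ρ).toAlgebra
    let _ := ((evenMap ρ).comp φ).toAlgebra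
    have : IsScalarTower K R.Even S.Even := IsScalarTower.of_algebraMap_eq' rfl
    have := hρ.isLocalization
    have hft : Algebra.FiniteType K S.Even := hft.finiteType
    exact hft.equiv ((IsLocalization.algEquiv (Submonoid.powers f) S.Even
      (Localization.Away f)).restrictScalars K)
  · choose S ρ hρ hft using fun f : t => f.2
    let _ (f : t) := (evenMap (ρ f)).toAlgebra
    let _ (f : t) : Module R.Even (S f) := Module.compHom (S f) (evenMap (ρ f))
    have (f : t) : IsScalarTower R.Even (S f).Even (S f) := ⟨fun a b x => mul_smul _ _ _⟩
    let g (f : t) : R →ₗ[R.Even] S f :=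
      { toFun := ringHom (ρ f)
        map_add' := map_add _
        map_smul' := ringHom_smul _ }
    have h₁ (f : t) : IsLocalization.Away f.1 (S f).Even := (hρ f).isLocalization
    have h₂ (f : t) : IsLocalizedModule.Away f.1 (g f) :=
      { map_units := by
          rintro ⟨_, n, rfl⟩
          obtain ⟨u, hu⟩ : IsUnit (evenMap (ρ f) (f.1 ^ n)) := by
            rw [map_pow]
            exact (hρ f).isUnit.pow n
          have hb : Function.Bijective fun x : S f => evenMap (ρ f) (f.1 ^ n) • x :=
            hu ▸ MulAction.bijective u
          exact (Module.End.isUnit_iff _).mpr hb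
        surj := fun y => by
          obtain ⟨n, x, hx⟩ := (hρ f).surj y
          rw [← map_pow] at hx
          exact ⟨(x, ⟨f.1 ^ n, n, rfl⟩), hx⟩
        exists_of_eq := fun {x y} hxy => by
          obtain ⟨n, hn⟩ := (hρ f).exists_pow_smul_eq_zero (x - y)
            (by rw [map_sub, sub_eq_zero]; exact hxy)
          refine ⟨⟨f.1 ^ n, n, rfl⟩, ?_⟩
          rwa [smul_sub, sub_eq_zero] at hn }
    exact Module.Finite.of_localizationSpan' t ht (Rₚ := fun f => (S f).Even) g
      fun f => (hft f).finite

/-- The even part of `x` commutes with `a`. The odd part `c` anticommutes with it, by expanding `(a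
+ c)² = 0`. Either way `a²` appears. -/
lemma mul_mul_self_of_odd {a : R} (ha : a ∈ R.grading 1) (x : R) : a * x * a = 0 := by
  obtain ⟨b, hb, c, hc, rfl⟩ := R.exists_even_add_odd x
  have h := R.odd_mul_self (a + c) (add_mem ha hc)
  rw [add_mul, mul_add, mul_add, R.odd_mul_self a ha, R.odd_mul_self c hc, zero_add, add_zero] at h
  have h1 : a * c = - (c * a) := eq_neg_of_add_eq_zero_left h
  rw [mul_add, add_mul, ← R.even_mul_odd_comm b hb a ha, h1, mul_assoc, R.odd_mul_self a ha,
    neg_mul, mul_assoc, R.odd_mul_self a ha, mul_zero, mul_zero, neg_zero, add_zero]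

lemma nodup_of_prod_ne_zero {l : List R} (hl : ∀ a ∈ l, a ∈ R.grading 1) (h : l.prod ≠ 0) :
    l.Nodup := by
  induction l with
  | nil => exact List.nodup_nil
  | cons a l ih =>
    rw [List.prod_cons] at h
    refine List.nodup_cons.mpr ⟨fun hal => h ?_, ih (fun b hb => hl b (List.mem_cons_of_mem _ hb))
      (right_ne_zero_of_mul h)⟩
    obtain ⟨l₁, l₂, rfl⟩ := List.append_of_mem hal
    rw [List.prod_append, List.prod_cons, ← mul_assoc, ← mul_assoc,
      mul_mul_self_of_odd (hl a List.mem_cons_self), zero_mul]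

open Pointwise in
-- Odd elements are `R₀`-combinations of the odd components `z` of a generating set. A product of
-- `s` of them is a combination of `s`-fold products from `z`, and these repeat a factor, hence
-- vanish, once `s` exceeds the size of `z`.
lemma exists_bound_of_prod_ne_zero [hfin : Module.Finite R.Even R] :
    ∃ N : ℕ, ∀ (s : ℕ) (y : Fin s → R), (∀ i, y i ∈ R.grading 1) → (List.ofFn y).prod ≠ 0 →
      s ≤ N := by
  classical
  obtain ⟨t, ht⟩ := hfin
  let z : Finset R := t.image (R.proj 1)
  refine ⟨z.card, fun s y hy hne => ?_⟩
  have hz (x : R) (hx : x ∈ R.grading 1) : x ∈ Submodule.span R.Even (z : Set R) := by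
    have h : (⊤ : Submodule R.Even R).map (R.proj 1) = Submodule.span R.Even (z : Set R) := by
      rw [← ht, Submodule.map_span, Finset.coe_image]
    rw [← h]
    exact ⟨x, trivial, proj_of_mem hx⟩
  by_contra hs
  have hmem : (List.ofFn y).prod ∈ Submodule.span R.Even (z : Set R) ^ s :=
    Submodule.pow_subset_pow _ (Set.mem_pow.mpr ⟨fun i => ⟨y i, hz _ (hy i)⟩, rfl⟩)
  rw [Submodule.span_pow] at hmem
  have hbot : Submodule.span R.Even ((z : Set R) ^ s) = ⊥ := by
    rw [Submodule.span_eq_bot]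
    intro x hx
    obtain ⟨w, rfl⟩ := Set.mem_pow.mp hx
    by_contra hw
    have hnd := nodup_of_prod_ne_zero (fun a ha => by
      obtain ⟨i, rfl⟩ := List.mem_ofFn.mp ha
      obtain ⟨b, -, hb⟩ := Finset.mem_image.mp (w i).2
      rw [← hb]
      exact R.proj_mem 1 b) hw
    rw [List.nodup_ofFn] at hnd
    have := Fintype.card_le_of_injective w fun i j hij => hnd (congrArg Subtype.val hij)
    simp only [Fintype.card_fin, Finset.coe_sort_coe, Fintype.card_coe] at this
    exact hs this
  rw [hbot] at hmem
  exact hne hmem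

/-- Super-ideals are in particular `R₀`-submodules of `R`, a finite module over a Noetherian ring.
-/
lemma IsFiniteTypeOver.isNoetherian (hφ : R.IsFiniteTypeOver φ) : R.IsNoetherian := by
  let _ := φ.toAlgebra
  have : Algebra.FiniteType K R.Even := hφ.finiteType
  have : IsNoetherianRing R.Even := Algebra.FiniteType.isNoetherianRing K R.Even
  have := hφ.finite
  let g (I : HomogeneousIdeal R.grading) : Submodule R.Even R :=
    I.toIdeal.restrictScalars R.Even
  have hg : StrictMono g := fun I J h => h
  exact hg.wellFoundedGT

/-- There are `s` odd elements the annihilator of whose product consists of nilpotent elements. -/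
def HasOddProduct (R : SuperRing.{u}) (s : ℕ) : Prop :=
  ∃ y : Fin s → R, (∀ i, y i ∈ R.grading 1) ∧
    ∀ a : R.Even, a • (List.ofFn y).prod = 0 → a ∈ nilradical R.Even

lemma mem_oddParameterLengths_iff (hN : (nilradical R.Even).IsPrime)
    (hd : ringKrullDim R.Even ≠ ⊤) {s : ℕ} : s ∈ R.oddParameterLengths ↔ R.HasOddProduct s :=
  exists_congr fun _ => and_congr_right fun _ => ringKrullDim_quotient_eq_iff hN hd _

lemma IsAway.evenMap_mem_nilradical_iff {ρ : R ⟶ S} {f : R.Even} (h : IsAway ρ f)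
    (hN : (nilradical R.Even).IsPrime) (hf : f ∉ nilradical R.Even) {a : R.Even} :
    evenMap ρ a ∈ nilradical S.Even ↔ a ∈ nilradical R.Even := by
  let _ := (evenMap ρ).toAlgebra
  have := h.isLocalization
  exact algebraMap_mem_nilradical_iff_of_away hN hf

/-- Clearing denominators changes the product only by a unit of `S`. Conversely, an annihilator
upstairs becomes, after multiplication by powers of `f`, one in `R`; primality of the nilradical
then removes those powers. -/
lemma IsAway.hasOddProduct_iff {ρ : R ⟶ S} {f : R.Even} (h : IsAway ρ f)
    (hN : (nilradical R.Even).IsPrime) (hf : f ∉ nilradical R.Even) {s : ℕ} :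
    S.HasOddProduct s ↔ R.HasOddProduct s := by
  constructor
  · rintro ⟨y, hy, hann⟩
    choose n x hx e using fun i => h.surj_of_mem (hy i)
    refine ⟨x, hx, fun a ha => (h.evenMap_mem_nilradical_iff hN hf).mp (hann _ ?_)⟩
    have key : ∃ m : ℕ, ringHom ρ (List.ofFn x).prod = evenMap ρ f ^ m • (List.ofFn y).prod := by
      clear hann ha hx hy
      induction s with
      | zero => exact ⟨0, by simp⟩
      | succ s ih =>
        obtain ⟨m, hm⟩ := ih (fun i => y i.succ) (fun i => n i.succ) (fun i => x i.succ)
          (fun i => e i.succ)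
        refine ⟨n 0 + m, ?_⟩
        rw [List.ofFn_succ, List.ofFn_succ, List.prod_cons, List.prod_cons, map_mul, hm, ← e 0,
          smul_mul_smul_comm, pow_add]
    obtain ⟨m, hm⟩ := key
    have h0 : evenMap ρ f ^ m • evenMap ρ a • (List.ofFn y).prod = 0 := by
      rw [smul_comm, ← hm, ← ringHom_smul, ha, map_zero]
    exact (h.isUnit.pow m).smul_eq_zero.mp h0
  · rintro ⟨y, hy, hann⟩
    refine ⟨fun i => ringHom ρ (y i), fun i => ringHom_mem ρ (hy i), fun a ha => ?_⟩
    obtain ⟨n, b, hb, e⟩ := h.surj_of_mem a.2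
    have e' : evenMap ρ f ^ n * a = evenMap ρ ⟨b, hb⟩ := Subtype.ext e
    have hprod : (List.ofFn fun i => ringHom ρ (y i)).prod = ringHom ρ (List.ofFn y).prod := by
      rw [map_list_prod, List.map_ofFn]
      rfl
    have h0 : ringHom ρ ((⟨b, hb⟩ : R.Even) • (List.ofFn y).prod) = 0 := by
      rw [ringHom_smul, ← e', mul_smul, ← hprod, ha, smul_zero]
    obtain ⟨m, hm⟩ := h.exists_pow_smul_eq_zero _ h0
    rw [← mul_smul] at hm
    have hb' := (hN.mem_or_mem (hann _ hm)).resolve_left fun h => hf (hN.mem_of_pow_mem m h)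
    rw [← h.evenMap_mem_nilradical_iff hN hf, ← e'] at hb'
    exact (Ideal.unit_mul_mem_iff_mem _ (h.isUnit.pow n)).mp hb'

lemma IsAway.ringKrullDim_eq (hφ : R.IsFiniteTypeOver φ) {ρ : R ⟶ S} {f : R.Even} (h : IsAway ρ f)
    (hN : (nilradical R.Even).IsPrime) (hf : f ∉ nilradical R.Even) :
    ringKrullDim S.Even = ringKrullDim R.Even := by
  let _ := φ.toAlgebra
  let _ := (evenMap ρ).toAlgebra
  have : Algebra.FiniteType K R.Even := hφ.finiteType
  have := h.isLocalization
  exact ringKrullDim_eq_of_away_of_isPrime K R.Even S.Even hN hf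

lemma IsFiniteTypeOver.exists_ringKrullDim_eq_natCast (hφ : R.IsFiniteTypeOver φ)
    (hN : (nilradical R.Even).IsPrime) : ∃ r : ℕ, ringKrullDim R.Even = r := by
  let _ := φ.toAlgebra
  have : Algebra.FiniteType K R.Even := hφ.finiteType
  exact _root_.exists_ringKrullDim_eq_natCast K R.Even hN

lemma IsFiniteTypeOver.exists_isGreatest (hφ : R.IsFiniteTypeOver φ)
    (hN : (nilradical R.Even).IsPrime) : ∃ s : ℕ, IsGreatest R.oddParameterLengths s := by
  obtain ⟨r, hr⟩ := hφ.exists_ringKrullDim_eq_natCast hN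
  have hd : ringKrullDim R.Even ≠ ⊤ := by
    rw [hr]
    exact fun h => by cases h
  have := hφ.finite
  obtain ⟨N, hbound⟩ := R.exists_bound_of_prod_ne_zero
  have h1 : (1 : R.Even) ∉ nilradical R.Even := fun h => hN.ne_top ((Ideal.eq_top_iff_one _).mpr h)
  have hbdd : BddAbove R.oddParameterLengths := by
    refine ⟨N, fun s hs => ?_⟩
    obtain ⟨y, hy, hann⟩ := (mem_oddParameterLengths_iff hN hd).mp hs
    exact hbound s y hy fun h0 => h1 (hann 1 (by rw [h0, smul_zero]))
  -- The empty family works: its product is `1`, with zero annihilator.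
  have hne : R.oddParameterLengths.Nonempty := by
    refine ⟨0, (mem_oddParameterLengths_iff hN hd).mpr ⟨Fin.elim0, fun i => i.elim0, fun a ha => ?_⟩⟩
    have : a = 0 := Subtype.ext (by simpa [even_smul_def] using ha)
    rw [this]
    exact zero_mem _
  exact ⟨sSup R.oddParameterLengths, Nat.sSup_mem hne hbdd, fun s hs => le_csSup hbdd hs⟩

lemma Ksdim₁_eq_of_isGreatest {s : ℕ} (h : IsGreatest R.oddParameterLengths s) : R.Ksdim₁ = s :=
  le_antisymm (iSup₂_le fun _ hn => Nat.cast_le.mpr (h.2 hn))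
    (le_iSup₂ (f := fun (n : ℕ) (_ : n ∈ R.oddParameterLengths) => (n : ℕ∞)) s h.1)

end SuperRing

end

/-! ### Finitely generated superalgebras, and comparison through a common localization. -/

noncomputable section

namespace SuperRing

variable {R S : SuperRing.{u}} {K : Type v} [Field K] {φ : K →+* R.Even}

lemma mul_mem_even_of_odd {a b : R} (ha : a ∈ R.grading 1) (hb : b ∈ R.grading 1) :
    a * b ∈ R.grading 0 :=
  SetLike.mul_mem_graded (A := R.grading) ha hb

/-- Let `A` be generated over `K` by the even components of the generators and the pairwise products
of their odd components, and let `M` be the `A`-span of the odd components. Then `M * M ⊆ A`, so `A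
+ M` is a subring containing all generators and equals `R`; comparing degrees gives `A = R₀`. -/
lemma IsFinitelyGenerated.isFiniteTypeOver (h : R.IsFinitelyGenerated φ) :
    R.IsFiniteTypeOver φ := by
  classical
  obtain ⟨t, ht⟩ := h
  let _ := φ.toAlgebra
  let p₀ : R → R.Even := fun x => ⟨R.proj 0 x, R.proj_mem 0 x⟩
  let q : R × R → R.Even := fun x => ⟨R.proj 1 x.1 * R.proj 1 x.2,
    mul_mem_even_of_odd (R.proj_mem 1 _) (R.proj_mem 1 _)⟩
  let e : Finset R.Even := t.image p₀ ∪ (t ×ˢ t).image q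
  let z : Finset R := t.image (R.proj 1)
  let A : Subalgebra K R.Even := Algebra.adjoin K (e : Set R.Even)
  let M : Submodule A R := Submodule.span A (z : Set R)
  have hA (a : A) (x : R) : a • x = ((a : R.Even) : R) * x := rfl
  have hMM : ∀ m ∈ M, ∀ n ∈ M, ∃ a : A, m * n = ((a : R.Even) : R) := by
    intro m hm n hn
    induction hm using Submodule.span_induction with
    | mem m hm =>
      induction hn using Submodule.span_induction with
      | mem n hn =>
        obtain ⟨x, hx, rfl⟩ := Finset.mem_image.mp hm
        obtain ⟨y, hy, rfl⟩ := Finset.mem_image.mp hn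
        exact ⟨⟨q (x, y), Algebra.subset_adjoin (Finset.mem_union_right _
          (Finset.mem_image_of_mem q (Finset.mk_mem_product hx hy)))⟩, rfl⟩
      | zero => exact ⟨0, mul_zero _⟩
      | add n n' _ _ h h' =>
        obtain ⟨a, ha⟩ := h
        obtain ⟨b, hb⟩ := h'
        exact ⟨a + b, by rw [mul_add, ha, hb]; rfl⟩
      | smul c n _ h =>
        obtain ⟨a, ha⟩ := h
        exact ⟨c * a, by rw [hA, ← mul_assoc, ← R.even_central, mul_assoc, ha]; rfl⟩
    | zero => exact ⟨0, zero_mul _⟩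
    | add m m' _ _ h h' =>
      obtain ⟨a, ha⟩ := h
      obtain ⟨b, hb⟩ := h'
      exact ⟨a + b, by rw [add_mul, ha, hb]; rfl⟩
    | smul c m _ h =>
      obtain ⟨a, ha⟩ := h
      exact ⟨c * a, by rw [hA, mul_assoc, ha]; rfl⟩
  let B : Subring R :=
    { carrier := {x | ∃ a : A, ∃ m ∈ M, x = ((a : R.Even) : R) + m}
      zero_mem' := ⟨0, 0, zero_mem _, (add_zero _).symm⟩
      one_mem' := ⟨1, 0, zero_mem _, (add_zero _).symm⟩
      add_mem' := by
        rintro _ _ ⟨a, m, hm, rfl⟩ ⟨b, n, hn, rfl⟩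
        exact ⟨a + b, m + n, add_mem hm hn, add_add_add_comm _ _ _ _⟩
      neg_mem' := by
        rintro _ ⟨a, m, hm, rfl⟩
        exact ⟨-a, -m, neg_mem hm, neg_add _ _⟩
      mul_mem' := by
        rintro _ _ ⟨a, m, hm, rfl⟩ ⟨b, n, hn, rfl⟩
        obtain ⟨c, hc⟩ := hMM m hm n hn
        refine ⟨a * b + c, a • n + b • m, add_mem (M.smul_mem a hn) (M.smul_mem b hm), ?_⟩
        rw [add_mul, mul_add, mul_add, hc, hA, hA, ← R.even_central b m]
        change _ = ((a : R.Even) : R) * ((b : R.Even) : R) + ((c : R.Even) : R) + _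
        abel }
  have hB (x : R) : x ∈ B := by
    have hle : Subring.closure (Set.range (fun k => (φ k : R)) ∪ t) ≤ B := by
      rw [Subring.closure_le]
      rintro x (⟨k, rfl⟩ | hx)
      · exact ⟨algebraMap K A k, 0, zero_mem _, (add_zero _).symm⟩
      · exact ⟨⟨p₀ x, Algebra.subset_adjoin (Finset.mem_union_left _
          (Finset.mem_image_of_mem p₀ hx))⟩, R.proj 1 x,
          Submodule.subset_span (Finset.mem_image_of_mem _ hx), (R.proj_add x).symm⟩
    exact hle (ht ▸ trivial)
  have hM : ∀ m ∈ M, m ∈ R.grading 1 := by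
    intro m hm
    induction hm using Submodule.span_induction with
    | mem m hm =>
      obtain ⟨x, hx, rfl⟩ := Finset.mem_image.mp hm
      exact R.proj_mem 1 x
    | zero => exact zero_mem _
    | add m n _ _ h h' => exact add_mem h h'
    | smul c m _ h => exact R.smul_mem_grading _ h
  constructor
  · change Algebra.FiniteType K R.Even
    refine ⟨e, eq_top_iff.mpr fun a _ => ?_⟩
    obtain ⟨b, m, hm, hab⟩ := hB a
    -- The element `m` is odd, and even as the difference of `a` and `b`.
    have h0 : m = 0 := by
      refine R.eq_zero_of_even_of_odd ?_ (hM m hm)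
      rw [← sub_eq_of_eq_add' hab]
      exact sub_mem a.2 b.1.2
    rw [h0, add_zero] at hab
    rw [Subtype.ext hab]
    exact b.2
  · refine ⟨insert 1 z, eq_top_iff.mpr fun x _ => ?_⟩
    obtain ⟨a, m, hm, rfl⟩ := hB x
    refine add_mem ?_ ?_
    · rw [← mul_one ((a : R.Even) : R), ← even_smul_def]
      exact Submodule.smul_mem _ _ (Submodule.subset_span (by simp))
    · have hle : M ≤ (Submodule.span R.Even ((insert 1 z : Finset R) : Set R)).restrictScalars A :=
        Submodule.span_le.mpr fun y hy => Submodule.subset_span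
          (Finset.mem_coe.mpr (Finset.mem_insert_of_mem hy))
      exact hle hm

lemma oddParameterLengths_eq_of_isAway {R' : SuperRing.{u}} {ψ : K →+* R'.Even}
    (hφ : R.IsFiniteTypeOver φ) (hψ : R'.IsFiniteTypeOver ψ)
    (hN : (nilradical R.Even).IsPrime) (hN' : (nilradical R'.Even).IsPrime)
    {ρ : R ⟶ S} {ρ' : R' ⟶ S} {f : R.Even} {f' : R'.Even}
    (h : IsAway ρ f) (h' : IsAway ρ' f') (hf : f ∉ nilradical R.Even)
    (hf' : f' ∉ nilradical R'.Even) :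
    R.oddParameterLengths = R'.oddParameterLengths := by
  have hd : ringKrullDim R.Even ≠ ⊤ := by
    obtain ⟨r, hr⟩ := hφ.exists_ringKrullDim_eq_natCast hN
    rw [hr]
    exact fun h => by cases h
  have hd' : ringKrullDim R'.Even ≠ ⊤ := by
    obtain ⟨r, hr⟩ := hψ.exists_ringKrullDim_eq_natCast hN'
    rw [hr]
    exact fun h => by cases h
  ext s
  rw [mem_oddParameterLengths_iff hN hd, mem_oddParameterLengths_iff hN' hd',
    ← h.hasOddProduct_iff hN hf, ← h'.hasOddProduct_iff hN' hf']

lemma Ksdim_eq_of_isAway {R' : SuperRing.{u}} {ψ : K →+* R'.Even}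
    (hφ : R.IsFiniteTypeOver φ) (hψ : R'.IsFiniteTypeOver ψ)
    (hN : (nilradical R.Even).IsPrime) (hN' : (nilradical R'.Even).IsPrime)
    {ρ : R ⟶ S} {ρ' : R' ⟶ S} {f : R.Even} {f' : R'.Even}
    (h : IsAway ρ f) (h' : IsAway ρ' f') (hf : f ∉ nilradical R.Even)
    (hf' : f' ∉ nilradical R'.Even) :
    R.Ksdim = R'.Ksdim := by
  refine Prod.ext ?_ ?_
  · exact (h.ringKrullDim_eq hφ hN hf).symm.trans (h'.ringKrullDim_eq hψ hN' hf')
  · simp only [Ksdim, Ksdim₁, oddParameterLengths_eq_of_isAway hφ hψ hN hN' h h' hf hf']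

end SuperRing

end

/-! ### Sections of affine superschemes, and charts. -/

noncomputable section

namespace SuperRing

variable {R S : SuperRing.{u}}

lemma ringHom_comp {T : SuperRing.{u}} (f : R ⟶ S) (g : S ⟶ T) (x : R) :
    ringHom (f ≫ g) x = ringHom g (ringHom f x) := rfl

lemma ringHom_bijective (f : R ⟶ S) [IsIso f] : Function.Bijective (ringHom f) := by
  refine Function.bijective_iff_has_inverse.mpr ⟨ringHom (inv f), fun x => ?_, fun x => ?_⟩
  · rw [← ringHom_comp, IsIso.hom_inv_id]
    rfl
  · rw [← ringHom_comp, IsIso.inv_hom_id]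
    rfl

lemma evenMap_bijective {f : R ⟶ S} (hf : Function.Bijective (ringHom f)) :
    Function.Bijective (evenMap f) := by
  refine ⟨fun a b h => Subtype.ext (hf.1 (congrArg Subtype.val h)), fun b => ?_⟩
  obtain ⟨x, hx⟩ := hf.2 b
  have hx0 : R.proj 0 x = x := hf.1 (by rw [ringHom_proj, hx, proj_of_mem b.2])
  exact ⟨⟨x, hx0 ▸ R.proj_mem 0 x⟩, Subtype.ext hx⟩

lemma evenMap_comp {T : SuperRing.{u}} (f : R ⟶ S) (g : S ⟶ T) :
    evenMap (f ≫ g) = (evenMap g).comp (evenMap f) := rfl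

lemma IsAway.of_comm {R' S' : SuperRing.{u}} {ρ : R ⟶ S} {f : R.Even} (h : IsAway ρ f)
    {a : R ⟶ R'} {b : S ⟶ S'} {ρ' : R' ⟶ S'} (ha : Function.Bijective (ringHom a))
    (hb : Function.Bijective (ringHom b)) (hcomm : ρ ≫ b = a ≫ ρ') :
    IsAway ρ' (evenMap a f) := by
  have hf : evenMap ρ' (evenMap a f) = evenMap b (evenMap ρ f) := by
    rw [← RingHom.comp_apply, ← RingHom.comp_apply, ← evenMap_comp, ← evenMap_comp, hcomm]
  have hx (x : R) : ringHom ρ' (ringHom a x) = ringHom b (ringHom ρ x) := by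
    rw [← ringHom_comp, ← ringHom_comp, hcomm]
  refine ⟨?_, fun y => ?_, fun x h0 => ?_⟩
  · rw [hf]
    exact h.isUnit.map _
  · obtain ⟨y, rfl⟩ := hb.2 y
    obtain ⟨n, x, e⟩ := h.surj y
    exact ⟨n, ringHom a x, by rw [hf, ← map_pow, ← ringHom_smul, e, hx]⟩
  · obtain ⟨x, rfl⟩ := ha.2 x
    rw [hx] at h0
    obtain ⟨n, hn⟩ := h.exists_pow_smul_eq_zero x (hb.1 (by rw [h0, map_zero]))
    exact ⟨n, by rw [← map_pow, ← ringHom_smul, hn, map_zero]⟩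

/-- An element of `R` as a section of the structure sheaf of `SSpec R`. -/
def toSpecSections (R : SuperRing.{u}) (U : Opens R.specTop) : R ⟶ R.specSuperRing U where
  toFun r := ⟨fun _ => LocalizedModule.mk r 1, fun p => ⟨⊤, trivial, r, 1, fun q _ =>
    ⟨q.1.asIdeal.primeCompl.one_mem, rfl⟩⟩⟩
  map_one' := Subtype.ext (funext fun p => OreLocalization.one_def.symm)
  map_mul' x y := Subtype.ext (funext fun p =>
    (LocalizedModule.mk_mul_mk.trans (by rw [one_mul])).symm)
  map_zero' := Subtype.ext (funext fun p => LocalizedModule.zero_mk 1)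
  map_add' x y := Subtype.ext (funext fun p =>
    (LocalizedModule.mk_add_mk.trans (by rw [one_mul, one_smul, one_smul])).symm)
  map_mem {i r} hr p := ⟨r, hr, 1, rfl⟩

lemma toSpecSections_comp_specRes (R : SuperRing.{u}) {U V : Opens R.specTop} (h : V ≤ U) :
    R.toSpecSections U ≫ R.specRes h = R.toSpecSections V := rfl

/-- The sections of the structure sheaf of `SSpec R` are the sections of the sheaf on the spectrum
of `R₀` associated with the `R₀`-module `R`. -/
def toStructureSheaf (R : SuperRing.{u}) (U : Opens R.specTop) (h : R.specSections U) :
    (structureSheafInType R.Even R).obj.obj (op U) :=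
  ⟨h.1, fun p => by
    obtain ⟨V, hV, r, s, e⟩ := R.specSections_isLocallyFraction h p
    exact ⟨V ⊓ U, ⟨hV, p.2⟩, homOfLE inf_le_right, r, s, fun q => e ⟨q.1, q.2.2⟩ q.2.1⟩⟩

lemma toStructureSheaf_toSpecSections (R : SuperRing.{u}) (U : Opens R.specTop) (x : R) :
    R.toStructureSheaf U (ringHom (R.toSpecSections U) x) =
      StructureSheaf.toOpenₗ R.Even R U x :=
  (StructureSheaf.toOpenₗ_eq_const U x).symm

lemma toStructureSheaf_injective (R : SuperRing.{u}) (U : Opens R.specTop) :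
    Function.Injective (R.toStructureSheaf U) :=
  fun _ _ h => Subtype.ext
    (congrArg (fun z : (structureSheafInType R.Even R).obj.obj (op U) => z.1) h)

/-- Transferred from the sheaf associated with the `R₀`-module `R`; injectivity of the comparison
map suffices for this. -/
lemma toSpecSections_top_bijective (R : SuperRing.{u}) :
    Function.Bijective (ringHom (R.toSpecSections ⊤)) := by
  have h := StructureSheaf.toOpenₗ_top_bijective (R := R.Even) (M := R)
  refine ⟨fun x y hxy => h.1 ?_, fun y => ?_⟩
  · exact (R.toStructureSheaf_toSpecSections ⊤ x).symm.trans
      ((congrArg (R.toStructureSheaf ⊤) hxy).trans (R.toStructureSheaf_toSpecSections ⊤ y))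
  · obtain ⟨x, hx⟩ := h.2 (R.toStructureSheaf ⊤ y)
    exact ⟨x, R.toStructureSheaf_injective ⊤ ((R.toStructureSheaf_toSpecSections ⊤ x).trans hx)⟩

lemma toStructureSheaf_smul (R : SuperRing.{u}) (U : Opens R.specTop) (a : R.Even)
    (y : R.specSuperRing U) :
    R.toStructureSheaf U (evenMap (R.toSpecSections U) a • y) = a • R.toStructureSheaf U y := by
  refine Subtype.ext (funext fun p => ?_)
  change LocalizedModule.mk (a : R) 1 * y.1 p = a • y.1 p
  generalize y.1 p = z
  induction z using LocalizedModule.induction_on with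
  | h r s => rw [LocalizedModule.mk_mul_mk, one_mul, LocalizedModule.smul'_mk, even_smul_def]

lemma isAway_toSpecSections (R : SuperRing.{u}) (f : R.Even) :
    IsAway (R.toSpecSections (PrimeSpectrum.basicOpen f)) f := by
  let U : Opens R.specTop := PrimeSpectrum.basicOpen f
  have hloc : IsLocalizedModule.Away f (StructureSheaf.toOpenₗ R.Even R U) := inferInstance
  refine ⟨?_, fun y => ?_, fun x hx => ?_⟩
  -- The section `1 / f` is the inverse of `f` on its basic open set; it is even because `1` is.
  · let g : R.specSections U := ⟨fun p => LocalizedModule.mk 1 ⟨f, p.2⟩, fun p =>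
      ⟨⊤, trivial, 1, f, fun q _ => ⟨q.2, rfl⟩⟩⟩
    let g₀ : (R.specSuperRing U).Even :=
      ⟨g, fun p => ⟨1, SetLike.one_mem_graded R.grading, ⟨f, p.2⟩, rfl⟩⟩
    refine IsUnit.of_mul_eq_one g₀ (Subtype.ext (Subtype.ext (funext fun p => ?_)))
    change (LocalizedModule.mk (f : R) 1 * LocalizedModule.mk (1 : R) ⟨f, p.2⟩ :
      R.AtPrime p.1) = 1
    rw [LocalizedModule.mk_mul_mk, one_mul, mul_one, OreLocalization.one_def]
    exact LocalizedModule.mk_eq.mpr ⟨1, by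
      rw [one_smul, one_smul, one_smul]
      exact (mul_one _).symm⟩
  · obtain ⟨⟨x, ⟨_, n, rfl⟩⟩, hx⟩ := IsLocalizedModule.surj (Submonoid.powers f)
      (StructureSheaf.toOpenₗ R.Even R U) (R.toStructureSheaf U y)
    refine ⟨n, x, R.toStructureSheaf_injective U ?_⟩
    rw [← map_pow]
    exact (R.toStructureSheaf_smul U _ y).trans
      (hx.trans (R.toStructureSheaf_toSpecSections U x).symm)
  · have h0 : StructureSheaf.toOpenₗ R.Even R U x = 0 :=
      (R.toStructureSheaf_toSpecSections U x).symm.trans (congrArg (R.toStructureSheaf U) hx)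
    obtain ⟨⟨_, n, rfl⟩, hn⟩ := (IsLocalizedModule.eq_zero_iff (Submonoid.powers f)
      (StructureSheaf.toOpenₗ R.Even R U)).mp h0
    exact ⟨n, hn⟩

end SuperRing

namespace GeometricSuperspace

open SuperRing

variable {X : GeometricSuperspace.{u}}

lemma res_bijective {U V : Opens X.carrier} (hUV : U ≤ V) (hVU : V ≤ U) :
    Function.Bijective (ringHom (X.presheaf.map (homOfLE hUV).op)) := by
  have : IsIso (homOfLE hUV) := ⟨homOfLE hVU, Subsingleton.elim _ _, Subsingleton.elim _ _⟩
  exact ringHom_bijective _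

/-- A homeomorphism of `U` with the spectrum of the even sections over `U` under which restriction
to the basic open sets is localization. -/
def IsChart {U : Opens X.carrier} (e : U ≃ₜ PrimeSpectrum (X.sections U).Even) : Prop :=
  ∀ (f : (X.sections U).Even) (V : Opens X.carrier) (hV : V ≤ U),
    (∀ x (hx : x ∈ U), x ∈ V ↔ f ∉ (e ⟨x, hx⟩).asIdeal) →
      IsAway (X.presheaf.map (homOfLE hV).op) f

/-- The isomorphism with `SSpec R` identifies `R` with `𝒪(U)`, and the localization property of
basic opens is carried over by naturality. From here on the ring `R` is replaced by `𝒪(U)` itself.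
-/
lemma IsAffineOpen.exists_isChart {U : Opens X.carrier} (hU : X.IsAffineOpen U) :
    ∃ e : U ≃ₜ PrimeSpectrum (X.sections U).Even, IsChart e := by
  obtain ⟨R, ⟨α⟩⟩ := hU
  let F := U.isOpenEmbedding.functor
  let b := α.hom.hom.base
  have hb : IsIso b := inferInstance
  have hc : IsIso α.hom.hom.c := inferInstance
  let e₀ : U ≃ₜ PrimeSpectrum R.Even := TopCat.homeoOfIso (asIso b)
  let c (W : Opens R.specTop) : R.specSuperRing W ⟶
    X.presheaf.obj (op (F.obj ((Opens.map b).obj W))) := α.hom.hom.c.app (op W)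
  have hcb (W) : Function.Bijective (ringHom (c W)) := by
    have : IsIso (c W) := inferInstanceAs (IsIso (α.hom.hom.c.app (op W)))
    exact ringHom_bijective _
  have hmem (W : Opens R.specTop) (x : X.carrier) (hx : x ∈ U) :
      x ∈ F.obj ((Opens.map b).obj W) ↔ e₀ ⟨x, hx⟩ ∈ W := by
    constructor
    · rintro ⟨y, hy, rfl⟩
      exact hy
    · intro h
      exact ⟨⟨x, hx⟩, h, rfl⟩
  -- These two opens have the same points; restriction along the mutual inclusions is bijective and
  -- replaces rewriting by an equality of opens.
  have hUtop : U ≤ F.obj ((Opens.map b).obj ⊤) := fun x hx => (hmem ⊤ x hx).mpr trivial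
  have hle (W : Opens R.specTop) : F.obj ((Opens.map b).obj W) ≤ U := by
    rintro _ ⟨y, hy, rfl⟩
    exact y.2
  let a : R ⟶ X.sections U :=
    R.toSpecSections ⊤ ≫ c ⊤ ≫ X.presheaf.map (homOfLE hUtop).op
  have ha : Function.Bijective (ringHom a) :=
    (res_bijective hUtop (hle ⊤)).comp ((hcb ⊤).comp R.toSpecSections_top_bijective)
  let a₀ : R.Even ≃+* (X.sections U).Even := RingEquiv.ofBijective _ (evenMap_bijective ha)
  refine ⟨e₀.trans (PrimeSpectrum.homeomorphOfRingEquiv a₀), fun f V hV h => ?_⟩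
  obtain ⟨f, rfl⟩ := a₀.surjective f
  have h' : ∀ x (hx : x ∈ U), x ∈ V ↔ f ∉ (e₀ ⟨x, hx⟩).asIdeal := by
    intro x hx
    rw [h x hx]
    change ¬ (a₀.symm (a₀ f) ∈ (e₀ ⟨x, hx⟩).asIdeal) ↔ _
    rw [a₀.symm_apply_apply]
  have hVF : V ≤ F.obj ((Opens.map b).obj (PrimeSpectrum.basicOpen f)) :=
    fun x hx => (hmem _ x (hV hx)).mpr ((h' x (hV hx)).mp hx)
  have hFV : F.obj ((Opens.map b).obj (PrimeSpectrum.basicOpen f)) ≤ V :=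
    fun x hx => (h' x (hle _ hx)).mpr ((hmem _ x (hle _ hx)).mp hx)
  refine (R.isAway_toSpecSections f).of_comm (a := a)
    (b := c (PrimeSpectrum.basicOpen f) ≫ X.presheaf.map (homOfLE hVF).op) ha
    ((res_bijective hVF hFV).comp (hcb _)) ?_
  have hnat : R.specRes le_top ≫ c (PrimeSpectrum.basicOpen f) = c ⊤ ≫
      X.presheaf.map (F.map ((Opens.map b).map (homOfLE le_top))).op :=
    α.hom.hom.c.naturality (homOfLE (le_top : PrimeSpectrum.basicOpen f ≤ ⊤)).op
  rw [← R.toSpecSections_comp_specRes le_top, Category.assoc, reassoc_of% hnat]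
  simp only [a, Category.assoc]
  refine congrArg (R.toSpecSections ⊤ ≫ c ⊤ ≫ ·) ?_
  exact (X.presheaf.map_comp _ _).symm.trans
    (X.presheaf.map_comp (homOfLE hUtop).op (homOfLE hV).op)

end GeometricSuperspace

end

/-! ### Basic opens common to two charts, and finite type on all affine opens. -/

noncomputable section

namespace GeometricSuperspace

open SuperRing

variable {X : GeometricSuperspace.{u}} {U V W : Opens X.carrier}

/-- The restriction map on even sections. -/
def evenRes (h : V ≤ U) : (X.sections U).Even →+* (X.sections V).Even :=
  evenMap (X.presheaf.map (homOfLE h).op)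

lemma evenRes_comp (h : V ≤ U) (h' : W ≤ V) :
    (evenRes h').comp (evenRes h) = evenRes (X := X) (h'.trans h) := by
  rw [evenRes, evenRes, ← evenMap_comp, ← X.presheaf.map_comp]
  rfl

lemma evenRes_evenRes (h : V ≤ U) (h' : W ≤ V) (a : (X.sections U).Even) :
    evenRes h' (evenRes h a) = evenRes (h'.trans h) a :=
  RingHom.congr_fun (evenRes_comp h h') a

/-- The basic open subset of `U` given by an even section over `U`. -/
def chartOpen (e : U ≃ₜ PrimeSpectrum (X.sections U).Even) (f : (X.sections U).Even) :
    Opens X.carrier where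
  carrier := {x | ∃ hx : x ∈ U, f ∉ (e ⟨x, hx⟩).asIdeal}
  is_open' := by
    have h := U.isOpen.isOpenMap_subtype_val _
      ((PrimeSpectrum.basicOpen f).isOpen.preimage e.continuous)
    convert h using 1
    ext x
    exact ⟨fun ⟨hx, hf⟩ => ⟨⟨x, hx⟩, hf, rfl⟩, fun ⟨y, hy, hyx⟩ => hyx ▸ ⟨y.2, hy⟩⟩

variable {e : U ≃ₜ PrimeSpectrum (X.sections U).Even}

lemma mem_chartOpen {f : (X.sections U).Even} {x : X.carrier} (hx : x ∈ U) :
    x ∈ chartOpen e f ↔ f ∉ (e ⟨x, hx⟩).asIdeal :=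
  ⟨fun h => h.2, fun h => ⟨hx, h⟩⟩

lemma chartOpen_le (f : (X.sections U).Even) : chartOpen e f ≤ U := fun _ hx => hx.1

lemma chartOpen_mul (f g : (X.sections U).Even) :
    chartOpen e (f * g) = chartOpen e f ⊓ chartOpen e g := by
  ext x
  constructor
  · rintro ⟨hx, h⟩
    exact ⟨⟨hx, fun hf => h (Ideal.mul_mem_right _ _ hf)⟩,
      ⟨hx, fun hg => h (Ideal.mul_mem_left _ _ hg)⟩⟩
  · rintro ⟨⟨hx, hf⟩, ⟨_, hg⟩⟩
    exact ⟨hx, fun h => ((e ⟨x, hx⟩).isPrime.mem_or_mem h).elim hf hg⟩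

lemma exists_mem_chartOpen_le (e : U ≃ₜ PrimeSpectrum (X.sections U).Even) {x : X.carrier}
    (hx : x ∈ U) {N : Opens X.carrier} (hxN : x ∈ N) : ∃ f, x ∈ chartOpen e f ∧ chartOpen e f ≤ N := by
  have hopen : IsOpen (e '' (Subtype.val ⁻¹' (N : Set X.carrier))) :=
    e.isOpenMap _ (N.isOpen.preimage continuous_subtype_val)
  obtain ⟨_, ⟨_, ⟨f, rfl⟩, rfl⟩, hxf, hfN⟩ :=
    PrimeSpectrum.isBasis_basic_opens.exists_subset_of_mem_open
      (Set.mem_image_of_mem e (show (⟨x, hx⟩ : U) ∈ _ from hxN)) hopen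
  refine ⟨f, ⟨hx, hxf⟩, fun y ⟨hy, hyf⟩ => ?_⟩
  obtain ⟨z, hz, hzy⟩ := hfN hyf
  rw [e.injective hzy] at hz
  exact hz

lemma IsChart.isAway (he : IsChart e) (f : (X.sections U).Even) :
    IsAway (X.presheaf.map (homOfLE (chartOpen_le (e := e) f)).op) f :=
  he f _ _ fun _ hx => mem_chartOpen hx

lemma IsChart.isUnit (he : IsChart e) (f : (X.sections U).Even) :
    IsUnit (evenRes (chartOpen_le (e := e) f) f) :=
  (he.isAway f).isUnit

/-- On a basic open `D(g) ⊆ V` around `x` the inverse of `f` is a fraction `c / g ^ n`, so `g ^ m *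
f * c = g ^ m * g ^ n` for some `m`. As `g` is outside the prime at `x`, so is `f`. -/
lemma IsChart.mem_chartOpen_of_isUnit (he : IsChart e) {f : (X.sections U).Even} (hV : V ≤ U)
    (hf : IsUnit (evenRes hV f)) {x : X.carrier} (hx : x ∈ V) : x ∈ chartOpen e f := by
  obtain ⟨g, hxg, hg⟩ := exists_mem_chartOpen_le e (hV hx) hx
  refine ⟨hV hx, fun hfx => hxg.2 ?_⟩
  have hu := hf.map (evenRes hg)
  rw [evenRes_evenRes] at hu
  obtain ⟨b, hb⟩ := hu.exists_right_inv
  obtain ⟨n, c, hc, hcb⟩ := (he.isAway g).surj_of_mem b.2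
  have hcb' : evenRes (chartOpen_le (e := e) g) g ^ n * b = evenRes (chartOpen_le g) ⟨c, hc⟩ :=
    Subtype.ext hcb
  have h0 : evenRes (chartOpen_le (e := e) g) (f * ⟨c, hc⟩ - g ^ n) = 0 := by
    rw [map_sub, map_mul, ← hcb', map_pow, mul_left_comm, hb, mul_one, sub_self]
  obtain ⟨m, hm⟩ := (he.isAway g).exists_pow_smul_eq_zero _ (congrArg Subtype.val h0)
  have hm' : g ^ m * (f * ⟨c, hc⟩ - g ^ n) = 0 := Subtype.ext hm
  have hmem : g ^ m * g ^ n ∈ (e ⟨x, hV hx⟩).asIdeal := by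
    rw [mul_sub, sub_eq_zero] at hm'
    rw [← hm']
    exact Ideal.mul_mem_left _ _ (Ideal.mul_mem_right _ _ hfx)
  rw [← pow_add] at hmem
  exact (e ⟨x, hV hx⟩).isPrime.mem_of_pow_mem _ hmem

/-- Choose `D(f) ⊆ V` basic in `U`, then `D(g) ⊆ D(f)` basic in `V`. Writing `g = a / f ^ n` on
`D(f)`, the set `D(g)` is also the basic open of `f * a` in `U`. -/
lemma IsChart.exists_common_isAway {e' : V ≃ₜ PrimeSpectrum (X.sections V).Even} (he : IsChart e)
    (he' : IsChart e') {x : X.carrier} (hx : x ∈ U) (hx' : x ∈ V) :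
    ∃ (W : Opens X.carrier) (hWU : W ≤ U) (hWV : W ≤ V) (f : (X.sections U).Even)
      (g : (X.sections V).Even), f ∉ (e ⟨x, hx⟩).asIdeal ∧ g ∉ (e' ⟨x, hx'⟩).asIdeal ∧
        IsAway (X.presheaf.map (homOfLE hWU).op) f ∧
        IsAway (X.presheaf.map (homOfLE hWV).op) g := by
  obtain ⟨f, hxf, hfV⟩ := exists_mem_chartOpen_le e hx hx'
  obtain ⟨g, hxg, hgf⟩ := exists_mem_chartOpen_le e' hx' hxf
  obtain ⟨n, a, ha, hag⟩ := (he.isAway f).surj_of_mem (evenRes hfV g).2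
  have hag' : evenRes (chartOpen_le (e := e) f) f ^ n * evenRes hfV g =
    evenRes (chartOpen_le f) ⟨a, ha⟩ := Subtype.ext hag
  have hres {N : Opens X.carrier} (hN : N ≤ chartOpen e f) :
      evenRes (hN.trans (chartOpen_le f)) f ^ n * evenRes (hN.trans hfV) g =
        evenRes (hN.trans (chartOpen_le f)) ⟨a, ha⟩ := by
    rw [← evenRes_evenRes hfV hN, ← evenRes_evenRes (chartOpen_le f) hN,
      ← evenRes_evenRes (chartOpen_le f) hN, ← hag', map_mul, map_pow]
  -- Both inclusions use `f ^ n * g = a` and the fact that a section is non-vanishing where it is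
  -- invertible: `a` is a unit on `D(g)`, and `g` is a unit on `D(f) ∩ D(a)`.
  have heq : chartOpen e' g = chartOpen e (f * ⟨a, ha⟩) := by
    rw [chartOpen_mul]
    apply le_antisymm
    · refine le_inf hgf fun y hy => ?_
      refine he.mem_chartOpen_of_isUnit (hgf.trans (chartOpen_le f)) ?_ hy
      rw [← hres hgf, ← evenRes_evenRes (chartOpen_le f) hgf]
      exact (((he.isUnit f).map _).pow n).mul (he'.isUnit g)
    · intro y hy
      have hN : chartOpen e f ⊓ chartOpen e ⟨a, ha⟩ ≤ chartOpen e f := inf_le_left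
      refine he'.mem_chartOpen_of_isUnit (hN.trans hfV) ?_ hy
      refine isUnit_of_mul_isUnit_right (x := evenRes (hN.trans (chartOpen_le f)) f ^ n) ?_
      rw [hres hN, ← evenRes_evenRes (chartOpen_le _) inf_le_right]
      exact (he.isUnit _).map _
  have hle : chartOpen e' g ≤ U := hgf.trans (chartOpen_le f)
  refine ⟨chartOpen e' g, hle, chartOpen_le g, f * ⟨a, ha⟩, g, ?_, hxg.2,
    he _ _ hle fun y hy => ?_, he'.isAway g⟩
  · rw [heq] at hxg
    exact hxg.2
  · rw [heq]
    exact mem_chartOpen hy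

/-- A non-empty open subset of an irreducible space is irreducible, and a spectrum is irreducible
exactly when the nilradical is prime. -/
lemma isPrime_nilradical_of_homeomorph [IrreducibleSpace X.carrier]
    (e : U ≃ₜ PrimeSpectrum (X.sections U).Even) (hU : (U : Set X.carrier).Nonempty) :
    (nilradical (X.sections U).Even).IsPrime := by
  rw [← PrimeSpectrum.irreducibleSpace_iff_isPrime_nilradical, ← e.irreducibleSpace_iff]
  have : Nonempty U := hU.to_subtype
  exact U.isOpen.isOpenEmbedding_subtypeVal.irreducibleSpace

lemma notMem_nilradical_of_notMem {R : Type*} [CommRing R] (p : PrimeSpectrum R) {f : R}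
    (hf : f ∉ p.asIdeal) : f ∉ nilradical R :=
  fun h => hf (nilradical_le_prime p.asIdeal h)

end GeometricSuperspace

namespace Superscheme

open SuperRing GeometricSuperspace

variable {K : Type v} [Field K] {X : Superscheme.{u}} {φ : X.StructureMap K}

lemma evenMap_comp_structureMapOn {U V : Opens X.carrier} (h : V ≤ U) :
    (evenMap (X.presheaf.map (homOfLE h).op)).comp (X.structureMapOn φ U) =
      X.structureMapOn φ V := by
  change (evenRes (X := X.toGeometricSuperspace) h).comp ((evenRes le_top).comp φ) = _
  rw [← RingHom.comp_assoc, evenRes_comp]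
  rfl

/-- Around each point, `U` shares a basic open with a member of the covering. Finiteness passes from
that member to the shared localization, and from these localizations to `𝒪(U)`. -/
lemma IsOfFiniteType.isFiniteTypeOver (hX : X.IsOfFiniteType φ) {U : Opens X.carrier}
    {e : U ≃ₜ PrimeSpectrum (X.sections U).Even} (he : IsChart e) :
    (X.sections U).IsFiniteTypeOver (X.structureMapOn φ U) := by
  obtain ⟨n, Y, hY, hft⟩ := hX
  refine .of_forall_exists_isAway fun p => ?_
  obtain ⟨⟨x, hx⟩, rfl⟩ := e.surjective p
  have hxY : x ∈ ⨆ i, Y i := hY ▸ trivial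
  obtain ⟨i, hi⟩ := Opens.mem_iSup.mp hxY
  obtain ⟨e', he'⟩ := (hft i).1.exists_isChart
  obtain ⟨W, hWU, hWY, f, g, hf, hg, haf, hag⟩ := he.exists_common_isAway he' hx hi
  refine ⟨f, hf, X.sections W, _, haf, ?_⟩
  rw [evenMap_comp_structureMapOn, ← evenMap_comp_structureMapOn hWY]
  exact (hft i).2.isFiniteTypeOver.of_isAway hag

end Superscheme

end

/-! ### The super-dimension of an irreducible superscheme of finite type. -/

noncomputable section

namespace Superscheme

open SuperRing GeometricSuperspace

variable {K : Type v} [Field K] {X : Superscheme.{u}} {φ : X.StructureMap K}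

lemma IsOfFiniteType.exists_forall_isAffineOpen (hX : X.IsOfFiniteType φ)
    [IrreducibleSpace X.carrier] :
    ∃ d : ℕ × ℕ, ∀ U : Opens X.carrier, X.IsAffineOpen U → (U : Set X.carrier).Nonempty →
      (X.sections U).IsNoetherian ∧
      IsGreatest (X.sections U).oddParameterLengths d.2 ∧
      (X.sections U).Ksdim = ((d.1 : WithBot ℕ∞), (d.2 : ℕ∞)) := by
  obtain ⟨x₀⟩ : Nonempty X.carrier := inferInstance
  obtain ⟨V, hxV, hV⟩ := X.exists_isAffineOpen x₀
  obtain ⟨e', he'⟩ := hV.exists_isChart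
  have hftV := hX.isFiniteTypeOver he'
  have hNV := isPrime_nilradical_of_homeomorph e' ⟨x₀, hxV⟩
  obtain ⟨r, hr⟩ := hftV.exists_ringKrullDim_eq_natCast hNV
  obtain ⟨s, hs⟩ := hftV.exists_isGreatest hNV
  refine ⟨(r, s), fun U hU hne => ?_⟩
  obtain ⟨e, he⟩ := hU.exists_isChart
  have hftU := hX.isFiniteTypeOver he
  have hNU := isPrime_nilradical_of_homeomorph e hne
  -- Irreducibility makes `U` meet the reference open `V`. The elements `f` and `g` obtained at a
  -- common point avoid a prime, so they are not nilpotent.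
  obtain ⟨x, hxU, hxV⟩ := nonempty_preirreducible_inter U.isOpen V.isOpen hne ⟨x₀, hxV⟩
  obtain ⟨W, hWU, hWV, f, g, hf, hg, haf, hag⟩ := he.exists_common_isAway he' hxU hxV
  have hf' := notMem_nilradical_of_notMem _ hf
  have hg' := notMem_nilradical_of_notMem _ hg
  have hlen := oddParameterLengths_eq_of_isAway hftU hftV hNU hNV haf hag hf' hg'
  refine ⟨hftU.isNoetherian, by rwa [hlen], ?_⟩
  rw [Ksdim_eq_of_isAway hftU hftV hNU hNV haf hag hf' hg']
  exact Prod.ext hr (Ksdim₁_eq_of_isGreatest hs)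

end Superscheme

end

theorem mainTheorem11 {K : Type v} [Field K] (X : Superscheme.{u}) (φ : X.StructureMap K)
    (hft : X.IsOfFiniteType φ) (hirr : IrreducibleSpace X.carrier) :
    (∀ U V : Opens X.carrier, X.IsAffineOpen U → X.IsAffineOpen V →
      (U : Set X.carrier).Nonempty → (V : Set X.carrier).Nonempty →
      (X.sections U).Ksdim = (X.sections V).Ksdim) ∧
    ∃! d : ℕ × ℕ, ∀ U : Opens X.carrier, X.IsAffineOpen U → (U : Set X.carrier).Nonempty →
      (X.sections U).IsNoetherian ∧
      IsGreatest (X.sections U).oddParameterLengths d.2 ∧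
      (X.sections U).Ksdim = ((d.1 : WithBot ℕ∞), (d.2 : ℕ∞)) := by
  obtain ⟨d, hd⟩ := hft.exists_forall_isAffineOpen
  refine ⟨fun U V hU hV hU' hV' => (hd U hU hU').2.2.trans (hd V hV hV').2.2.symm, d, hd,
    fun d' hd' => ?_⟩
  -- Uniqueness needs an actual non-empty affine open, on which the pair is read off from `Ksdim`.
  obtain ⟨x⟩ : Nonempty X.carrier := inferInstance
  obtain ⟨U, hxU, hU⟩ := X.exists_isAffineOpen x
  have h := (hd' U hU ⟨x, hxU⟩).2.2.symm.trans (hd U hU ⟨x, hxU⟩).2.2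
  rw [Prod.mk.injEq] at h
  exact Prod.ext (by exact_mod_cast h.1) (by exact_mod_cast h.2)
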